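/- Let $q$ be a prime power, $n\in\mathbb N$, and let $U=U_n(q)$ be the group of upper unitriangular $n\times n$ matrices over $\mathbb F_q$. Fix a nontrivial linear character $\psi:(\mathbb F_q,+)\to\mathbb C^\times$. Identify the positive roots of $GL_n$ with the positions $(a,b)$, $1\le a<b\le n$, and let $X_{(a,b)}=\{I_n+c\,e_{a,b}: c\in\mathbb F_q\}$ be the corresponding root subgroup. For a root $\alpha=(a,b)$ put $\mathrm{arm}(\alpha)=\{(a,c): a<c<b\}$ and $V_\alpha=\langle X_\beta:\beta\notin \mathrm{arm}(\alpha)\rangle$. For $s\in\mathbb F_q^\times$ let $\lambda_{\alpha,s}$ be the linear character of $V_\alpha$ given by $g\mapsto\psi(s\,g_{a,b})$; it is the linear character with $I_n+c\,e_{a,b}\mapsto\psi(cs)$ that is trivial on every other $X_\beta\subset V_\alpha$. For a subgroup $H$ of a finite group $G$ and a character $\xi$ of $H$, $\xi^G$ is the induced character. $\mathrm{Irr}(\eta)$ is the set of irreducible constituents of a character $\eta$, and $\mathrm{Irr}(G,\xi)=\mathrm{Irr}(\xi^G)$. Let $D$ be a basic set, i.e. a nonempty set of positive roots no two of which lie in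 the same row or in the same column, and let $\phi=(\lambda_{\alpha,s_\alpha})_{\alpha\in D}$ with $s_\alpha\in\mathbb F_q^\times$. Define the supercharacter and the groups $$\xi_{D,\phi}=\prod_{\alpha\in D}(\lambda_{\alpha,s_\alpha})^U,\qquad V_D=\bigcap_{\alpha\in D}V_\alpha,\qquad \lambda_D=\prod_{\alpha\in D}\lambda_{\alpha,s_\alpha}|_{V_D},\qquad R_D=\langle X_\gamma:\gamma\in\Gamma_D\rangle,$$ where $\Gamma_D$ is the set of all roots $(a,a')$ such that there are $(a,b),(a',b')\in D$ with $a<a'$ and $b<b'$. Then $\langle V_D,R_D\rangle=V_DR_D$, the set $\mathrm{Irr}(V_DR_D,\lambda_D)$ is finite, and: (i) $\mathrm{Irr}(\xi_{D,\phi})=\{\chi^U:\chi\in \mathrm{Irr}(V_DR_D,\lambda_D)\}$; (ii) $\xi_{D,\phi}=\sum_{\chi\in \mathrm{Irr}(V_DR_D,\lambda_D)}\chi(1)\,\chi^U$, and for each $\chi\in\mathrm{Irr}(V_DR_D,\lambda_D)$ the constituent $\chi^U$ has multiplicity $\chi(1)$ in $\xi_{D,\phi}$. -/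

import Mathlib

open scoped Pointwise

noncomputable section

namespace UniTri

/-! ### Characters of finite groups -/

section Characters

variable {G : Type*} [Group G]

/-- The set `Irr(G)` of irreducible complex characters of `G`, as functions `G → ℂ`:
the characters of the irreducible representations of `G` on the spaces `ℂ^d`. -/
def Irr (G : Type*) [Group G] : Set (G → ℂ) :=
  {χ | ∃ (d : ℕ) (ρ : Representation ℂ G (Fin d → ℂ)), ρ.IsIrreducible ∧ ρ.character = χ}

/-- The inner product `(χ, ψ) = |G|⁻¹ ∑_g χ(g) ψ(g⁻¹)` of characters of a finite group.
For a character `ψ`, `ψ(g⁻¹)` is the complex conjugate of `ψ(g)`. -/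
def charInner [Finite G] (χ ψ : G → ℂ) : ℂ :=
  (Nat.card G : ℂ)⁻¹ * ∑ᶠ g : G, χ g * ψ g⁻¹

/-- The set `Irr(ξ)` of irreducible constituents of a character `ξ` of `G`. -/
def constituents [Finite G] (ξ : G → ℂ) : Set (G → ℂ) :=
  {χ ∈ Irr G | charInner χ ξ ≠ 0}

open Classical in
/-- For subgroups `H ≤ K` of a group, the induced function `f^K` of a function `f` on `H`:
`f^K(k) = |H|⁻¹ ∑_{x ∈ K, x⁻¹ k x ∈ H} f(x⁻¹ k x)`. -/
def induce [Finite G] (H K : Subgroup G) (f : H → ℂ) (k : K) : ℂ :=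
  (Nat.card H : ℂ)⁻¹ *
    ∑ᶠ x : K, if h : (x : G)⁻¹ * k * x ∈ H then f ⟨(x : G)⁻¹ * k * x, h⟩ else 0

/-- For `H ≤ K` and a character `f` of `H`, the set `Irr(K, f)` of irreducible constituents
of `f^K`. -/
def IrrOver [Finite G] (H K : Subgroup G) (f : H → ℂ) : Set (K → ℂ) :=
  constituents (induce H K f)

end Characters

/-! ### Positive roots, root subgroups and the unitriangular group -/

/-- The positive roots of `GL_n`. The root `α_i + ⋯ + α_j` (`1 ≤ i ≤ j < n`) is represented by
the matrix position `(i, j + 1)` of its root subgroup (with positions counted from `0`). -/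
@[ext]
structure PosRoot (n : ℕ) where
  row : Fin n
  col : Fin n
  lt : row < col

/-- The arm of a root: the roots strictly to the left of it in its row. -/
def PosRoot.arm {n : ℕ} (α : PosRoot n) : Set (PosRoot n) :=
  {β | β.row = α.row ∧ β.col < α.col}

variable {n : ℕ} {F : Type*} [Field F]

/-- The matrix `1 + c e_{a,b}`, for the root `β` at position `(a, b)`. -/
def rootElt (β : PosRoot n) (c : F) : GL (Fin n) F where
  val := Matrix.transvection β.row β.col c
  inv := Matrix.transvection β.row β.col (-c)
  val_inv := by
    rw [Matrix.transvection_mul_transvection_same _ _ β.lt.ne, add_neg_cancel,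
      Matrix.transvection_zero]
  inv_val := by
    rw [Matrix.transvection_mul_transvection_same _ _ β.lt.ne, neg_add_cancel,
      Matrix.transvection_zero]

/-- The root subgroup `X_β`. -/
def rootSubgroup (F : Type*) [Field F] (β : PosRoot n) : Subgroup (GL (Fin n) F) where
  carrier := Set.range (rootElt β)
  mul_mem' := by
    rintro _ _ ⟨c, rfl⟩ ⟨d, rfl⟩
    exact ⟨c + d, Units.ext
      (Matrix.transvection_mul_transvection_same _ _ β.lt.ne c d).symm⟩
  one_mem' := ⟨0, Units.ext (Matrix.transvection_zero _ _)⟩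
  inv_mem' := by
    rintro _ ⟨c, rfl⟩
    exact ⟨-c, Units.ext rfl⟩

/-- The subgroup generated by the root subgroups `X_β`, `β ∈ S`. -/
def rootGenerated (F : Type*) [Field F] (S : Set (PosRoot n)) : Subgroup (GL (Fin n) F) :=
  ⨆ β ∈ S, rootSubgroup F β

/-- The group `U_n(F)` of upper triangular matrices with all diagonal entries equal to `1`. -/
def U (n : ℕ) (F : Type*) [Field F] : Subgroup (GL (Fin n) F) where
  carrier := {g | (∀ i, g i i = 1) ∧ ∀ i j, j < i → g i j = 0}
  mul_mem' := by
    rintro g h ⟨hg1, hg⟩ ⟨hh1, hh⟩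
    refine ⟨fun i => ?_, fun i j hij => ?_⟩
    · rw [Units.val_mul, Matrix.mul_apply, Finset.sum_eq_single i, hg1, hh1, one_mul]
      · intro k _ hk
        rcases lt_or_gt_of_ne hk with h1 | h1
        · rw [hg _ _ h1, zero_mul]
        · rw [hh _ _ h1, mul_zero]
      · simp
    · rw [Units.val_mul, Matrix.mul_apply]
      refine Finset.sum_eq_zero fun k _ => ?_
      rcases lt_or_ge k i with h1 | h1
      · rw [hg _ _ h1, zero_mul]
      · rw [hh _ _ (hij.trans_le h1), mul_zero]
  one_mem' := by
    refine ⟨fun i => by simp, fun i j hij => ?_⟩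
    simp [Matrix.one_apply_ne hij.ne']
  inv_mem' := by
    rintro g ⟨hg1, hg⟩
    have ht : ∀ i j, j < i → (g⁻¹ : GL (Fin n) F) i j = 0 := by
      have : Invertible (g : Matrix (Fin n) (Fin n) F) := g.invertible
      have hb : Matrix.BlockTriangular (g : Matrix (Fin n) (Fin n) F) id := fun i j h => hg i j h
      have := Matrix.blockTriangular_inv_of_blockTriangular hb
      intro i j hij
      rw [Matrix.coe_units_inv]
      exact this hij
    refine ⟨fun i => ?_, ht⟩
    have h1 : (g * g⁻¹ : GL (Fin n) F) i i = 1 := by simp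
    rw [Units.val_mul, Matrix.mul_apply, Finset.sum_eq_single i, hg1, one_mul] at h1
    · exact h1
    · intro k _ hk
      rcases lt_or_gt_of_ne hk with h2 | h2
      · rw [hg _ _ h2, zero_mul]
      · rw [ht _ _ h2, mul_zero]
    · simp

/-! ### Base groups and their linear characters -/

/-- The base group `V_α`, generated by all `X_β` with `β` not in the arm of `α`. -/
def baseGroup (F : Type*) [Field F] (α : PosRoot n) : Subgroup (GL (Fin n) F) :=
  rootGenerated F α.armᶜ

/-- The matrices of `U_n(F)` that vanish on the arm of `α` form a subgroup. -/
def armFree (F : Type*) [Field F] (α : PosRoot n) : Subgroup (GL (Fin n) F) where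
  carrier := {g | g ∈ U n F ∧ ∀ k, α.row < k → k < α.col → g α.row k = 0}
  mul_mem' := by
    rintro g h ⟨hgU, hg⟩ ⟨hhU, hh⟩
    refine ⟨mul_mem hgU hhU, fun k hk1 hk2 => ?_⟩
    rw [Units.val_mul, Matrix.mul_apply]
    refine Finset.sum_eq_zero fun l _ => ?_
    rcases lt_trichotomy l α.row with h1 | rfl | h1
    · rw [hgU.2 _ _ h1, zero_mul]
    · rw [hh _ hk1 hk2, mul_zero]
    · rcases lt_or_ge l α.col with h2 | h2
      · rw [hg _ h1 h2, zero_mul]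
      · rw [hhU.2 _ _ (hk2.trans_le h2), mul_zero]
  one_mem' := ⟨one_mem _, fun k hk _ => by simp [Matrix.one_apply_ne hk.ne]⟩
  inv_mem' := by
    rintro g ⟨hgU, hg⟩
    have hiU := inv_mem hgU
    refine ⟨hiU, fun k hk1 hk2 => ?_⟩
    have h1 : (g * g⁻¹ : GL (Fin n) F) α.row k = 0 := by simp [Matrix.one_apply_ne hk1.ne]
    rw [Units.val_mul, Matrix.mul_apply, Finset.sum_eq_single α.row, hgU.1, one_mul] at h1
    · exact h1
    · intro l _ hl
      rcases lt_or_gt_of_ne hl with h2 | h2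
      · rw [hgU.2 _ _ h2, zero_mul]
      · rcases lt_or_ge l α.col with h3 | h3
        · rw [hg _ h2 h3, zero_mul]
        · rw [hiU.2 _ _ (hk2.trans_le h3), mul_zero]
    · simp

lemma baseGroup_le_armFree (α : PosRoot n) : baseGroup F α ≤ armFree F α := by
  refine iSup₂_le fun β hβ => ?_
  rintro _ ⟨c, rfl⟩
  have key : ∀ i j, (rootElt β c : GL (Fin n) F) i j =
      (1 : Matrix (Fin n) (Fin n) F) i j + if β.row = i ∧ β.col = j then c else 0 := by
    intro i j
    simp [rootElt, Matrix.transvection, Matrix.single_apply]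
  have hlt := β.lt
  refine ⟨⟨fun i => ?_, fun i j hij => ?_⟩, fun k hk1 hk2 => ?_⟩
  · rw [key, if_neg, Matrix.one_apply_eq, add_zero]
    rintro ⟨rfl, h⟩
    exact hlt.ne' h
  · rw [key, if_neg, Matrix.one_apply_ne hij.ne', add_zero]
    rintro ⟨rfl, rfl⟩
    exact lt_asymm hij hlt
  · rw [key, if_neg, Matrix.one_apply_ne hk1.ne, add_zero]
    rintro ⟨h, rfl⟩
    exact hβ ⟨h, hk2⟩

lemma baseGroup_le_U (α : PosRoot n) : baseGroup F α ≤ U n F :=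
  fun _ hg => (baseGroup_le_armFree α hg).1

/-- The linear character `λ_{α,s}` of the base group `V_α`: it sends `g` to `ψ(s g_{a,b})`,
where `(a, b)` is the position of `α`. See `lam_rootElt_self` and `lam_rootElt_of_ne`. -/
def lam (ψ : AddChar F ℂ) (α : PosRoot n) (s : Fˣ) : baseGroup F α →* ℂ where
  toFun g := ψ (s * (g : GL (Fin n) F) α.row α.col)
  map_one' := by simp [Matrix.one_apply_ne α.lt.ne]
  map_mul' := by
    rintro ⟨g, hg⟩ ⟨h, hh⟩
    obtain ⟨hgU, hg⟩ := baseGroup_le_armFree α hg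
    obtain ⟨hhU, -⟩ := baseGroup_le_armFree α hh
    rw [← AddChar.map_add_eq_mul, ← mul_add]
    congr 2
    change (g * h : GL (Fin n) F) α.row α.col = g α.row α.col + h α.row α.col
    rw [Units.val_mul, Matrix.mul_apply,
      Finset.sum_eq_add_of_mem α.col α.row (Finset.mem_univ _) (Finset.mem_univ _) α.lt.ne',
      hgU.1, hhU.1, mul_one, one_mul]
    rintro k - ⟨hk1, hk2⟩
    rcases lt_or_gt_of_ne hk2 with h1 | h1
    · rw [hgU.2 _ _ h1, zero_mul]
    · rcases lt_or_gt_of_ne hk1 with h2 | h2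
      · rw [hg _ h1 h2, zero_mul]
      · rw [hhU.2 _ _ h2, mul_zero]

/-- On `X_α`, the character `λ_{α,s}` is `x_α(c) ↦ ψ(c s)`. -/
lemma lam_rootElt_self (ψ : AddChar F ℂ) (α : PosRoot n) (s : Fˣ) (c : F)
    (h : rootElt α c ∈ baseGroup F α) : lam ψ α s ⟨rootElt α c, h⟩ = ψ (c * s) := by
  simp [lam, rootElt, Matrix.transvection, Matrix.one_apply_ne α.lt.ne, mul_comm]

/-- On the other root subgroups of `V_α`, the character `λ_{α,s}` is trivial. -/
lemma lam_rootElt_of_ne (ψ : AddChar F ℂ) (α β : PosRoot n) (hβ : β ≠ α) (s : Fˣ) (c : F)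
    (h : rootElt β c ∈ baseGroup F α) : lam ψ α s ⟨rootElt β c, h⟩ = 1 := by
  have : ¬ (β.row = α.row ∧ β.col = α.col) := fun h => hβ (PosRoot.ext h.1 h.2)
  simp [lam, rootElt, Matrix.transvection, Matrix.one_apply_ne α.lt.ne, this]

/-! ### Basic sets, supercharacters and the groups `V_D`, `R_D` -/

/-- A basic set is a nonempty set of positive roots, no two in the same row or column. -/
def IsBasic (D : Finset (PosRoot n)) : Prop :=
  D.Nonempty ∧ ∀ α ∈ D, ∀ β ∈ D, α ≠ β → α.row ≠ β.row ∧ α.col ≠ β.col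

/-- The supercharacter `ξ_{D,φ}`, the product over `α ∈ D` of the elementary characters
`(λ_{α,s_α})^U`. The choice of a `λ_{α,s_α}` for each `α ∈ D` is given by `s`. -/
def superchar [Finite F] (ψ : AddChar F ℂ) (D : Finset (PosRoot n)) (s : D → Fˣ) :
    U n F → ℂ :=
  ∏ α : D, induce (baseGroup F α.1) (U n F) (lam ψ α.1 (s α))

/-- `V_D`, the intersection of the base groups `V_α`, `α ∈ D`. -/
def VD (F : Type*) [Field F] (D : Finset (PosRoot n)) : Subgroup (GL (Fin n) F) :=
  ⨅ α : D, baseGroup F α.1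

/-- The linear character `λ_D` of `V_D`, the product of the restrictions of the `λ_{α,s_α}`. -/
def lamD (ψ : AddChar F ℂ) (D : Finset (PosRoot n)) (s : D → Fˣ) : VD F D →* ℂ :=
  ∏ α : D, (lam ψ α.1 (s α)).comp (Subgroup.inclusion (iInf_le _ α))

/-- `Γ_D`: for `σ, τ ∈ D` with `τ` strictly to the right of and strictly below `σ`, it contains
the root `γ` in the row of `σ` for which `γ + τ` is a root, i.e. the root whose column index is
the row index of `τ`. -/
def GammaD (D : Finset (PosRoot n)) : Set (PosRoot n) :=
  {γ | ∃ σ ∈ D, ∃ τ ∈ D, σ.col < τ.col ∧ σ.row < τ.row ∧ γ.row = σ.row ∧ γ.col = τ.row}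

/-- `R_D`, generated by the root subgroups `X_γ`, `γ ∈ Γ_D`. -/
def RD (F : Type*) [Field F] (D : Finset (PosRoot n)) : Subgroup (GL (Fin n) F) :=
  rootGenerated F (GammaD D)

/-- The subgroup `⟨V_D, R_D⟩` (which is the set product `V_D R_D`). -/
def VDRD (F : Type*) [Field F] (D : Finset (PosRoot n)) : Subgroup (GL (Fin n) F) :=
  VD F D ⊔ RD F D

lemma VD_le_VDRD (D : Finset (PosRoot n)) : VD F D ≤ VDRD F D := le_sup_left

end UniTri

end

/-! The argument concentrates everything on the pair (V_D, λ_D).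

First, ξ_{D,φ} is itself induced: it equals λ_D^U (`superchar_eq_induce`). A product of characters
induced from linear characters of subgroups H_i is induced from their intersection as soon as any
choice of cosets of the H_i has a common element (`prod_induce`). The base group V_α constrains only
the row of α, and the rows of D are distinct, so such an element can be assembled row by row.

Second, write H = V_D R_D. It normalizes V_D and fixes λ_D (`VDRD_le_charStabilizer`), so V_D acts
by λ_D in each χ ∈ Irr(H, λ_D), and χ occurs χ(1) times in λ_D^H. Moreover every element of U
intertwining λ_D lies in H (`containsIntertwiners_lamD`). By Mackey's formula, induction from H to U
then preserves inner products on Irr(H, λ_D) (`charInner_induce_induce`). Hence the χ^U are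
irreducible and pairwise distinct, and inducing the decomposition of λ_D^H to U gives both claims.

The intertwiners are found by treating the roots of D from right to left. Testing an intertwiner on
root elements in the column of α shows that its entries on the arm of α vanish, except in columns
indexed by the row of a root of D further right. These exceptional positions belong to Γ_D, so a
factor from R_D clears them; in the end an element of V_D remains. -/

open scoped Pointwise

noncomputable section

namespace UniTri

/-! ### Irreducible characters of finite groups -/

section CharacterTheory

open Representation
open scoped MonoidAlgebra

variable {G : Type*} [Group G]

/-- The character of any finite-dimensional irreducible representation lies in `Irr G`. -/
lemma character_mem_Irr {V : Type*} [AddCommGroup V] [Module ℂ V] [FiniteDimensional ℂ V]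
    (ρ : Representation ℂ G V) [hρ : ρ.IsIrreducible] : ρ.character ∈ Irr G := by
  let e : V ≃ₗ[ℂ] (Fin (Module.finrank ℂ V) → ℂ) := (Module.finBasis ℂ V).equivFun
  let σ : Representation ℂ G (Fin (Module.finrank ℂ V) → ℂ) :=
    { toFun := fun g => e.conj (ρ g)
      map_one' := by ext; simp
      map_mul' := fun g h => by ext; simp [LinearEquiv.conj_apply] }
  let E : ρ.Equiv σ := Representation.Equiv.mk e fun g => by
    ext v : 1
    simp [σ, LinearEquiv.conj_apply]
  refine ⟨_, σ, ?_, (char_iso E).symm⟩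
  rw [irreducible_iff_isSimpleModule_asModule] at hρ ⊢
  exact IsSimpleModule.congr (LinearEquiv.ofBijective
    (IntertwiningMap.equivLinearMapAsModule ρ σ E.toIntertwiningMap) e.bijective).symm

/-- Schur's lemma. -/
lemma exists_eq_smul_id_of_commute {V : Type*} [AddCommGroup V] [Module ℂ V]
    [FiniteDimensional ℂ V] (ρ : Representation ℂ G V) [ρ.IsIrreducible] (T : V →ₗ[ℂ] V)
    (hT : ∀ g, T ∘ₗ ρ g = ρ g ∘ₗ T) : ∃ c : ℂ, T = c • LinearMap.id := by
  let t : IntertwiningMap ρ ρ := ⟨T, hT⟩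
  obtain ⟨c, hc⟩ := (IsIrreducible.algebraMap_intertwiningMap_bijective_of_isAlgClosed
    (ρ := ρ)).2 t
  refine ⟨c, ?_⟩
  have := congrArg IntertwiningMap.toLinearMap hc
  rw [← show t.toLinearMap = T from rfl, ← this]
  rfl

/-- A class function: a function constant on conjugacy classes. -/
def IsClassFun (f : G → ℂ) : Prop :=
  ∀ x g, f (x⁻¹ * g * x) = f g

lemma isClassFun_of_mem_Irr {χ : G → ℂ} (hχ : χ ∈ Irr G) : IsClassFun χ := by
  obtain ⟨d, ρ, -, rfl⟩ := hχ
  intro x g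
  simpa using char_conj ρ g x⁻¹

section Finite

variable [Finite G]

lemma charInner_eq [Fintype G] (f g : G → ℂ) :
    charInner f g = (Nat.card G : ℂ)⁻¹ * ∑ x, f x * g x⁻¹ := by
  rw [charInner, finsum_eq_sum_of_fintype]

lemma charInner_comm (f g : G → ℂ) : charInner f g = charInner g f := by
  have := Fintype.ofFinite G
  rw [charInner_eq, charInner_eq, ← Equiv.sum_comp (Equiv.inv G)]
  simp [mul_comm]

lemma charInner_sub_left (f₁ f₂ g : G → ℂ) :
    charInner (f₁ - f₂) g = charInner f₁ g - charInner f₂ g := by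
  have := Fintype.ofFinite G
  simp only [charInner_eq, Pi.sub_apply, sub_mul, Finset.sum_sub_distrib, mul_sub]

lemma charInner_sum_left {ι : Type*} (s : Finset ι) (c : ι → ℂ) (f : ι → G → ℂ) (g : G → ℂ) :
    charInner (∑ i ∈ s, c i • f i) g = ∑ i ∈ s, c i * charInner (f i) g := by
  have := Fintype.ofFinite G
  simp only [charInner_eq, Finset.sum_apply, Pi.smul_apply, smul_eq_mul, Finset.sum_mul,
    Finset.mul_sum]
  rw [Finset.sum_comm]
  exact Finset.sum_congr rfl fun i _ => Finset.sum_congr rfl fun x _ => by ring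

lemma charInner_sum_right {ι : Type*} (s : Finset ι) (c : ι → ℂ) (f : ι → G → ℂ) (g : G → ℂ) :
    charInner g (∑ i ∈ s, c i • f i) = ∑ i ∈ s, c i * charInner g (f i) := by
  rw [charInner_comm, charInner_sum_left]
  simp only [charInner_comm g]

open Classical in
/-- The first orthogonality relation. -/
lemma charInner_of_mem_Irr {χ χ' : G → ℂ} (hχ : χ ∈ Irr G) (hχ' : χ' ∈ Irr G) :
    charInner χ χ' = if χ = χ' then 1 else 0 := by
  have := Fintype.ofFinite G
  obtain ⟨d, ρ, hρ, rfl⟩ := hχ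
  obtain ⟨d', ρ', hρ', rfl⟩ := hχ'
  have : Invertible (Nat.card G : ℂ) :=
    invertibleOfNonzero (Nat.cast_ne_zero.2 Nat.card_pos.ne')
  have key := char_orthonormal ρ ρ'
  rw [← charInner_eq] at key
  by_cases h : Nonempty (ρ'.Equiv ρ)
  · rw [key, if_pos h, if_pos (char_iso h.some).symm]
  · rw [if_neg]
    · rw [key, if_neg h]
    · intro hc
      -- Equal characters of inequivalent irreducible representations would have inner product both
      -- 0 and 1.
      rw [if_neg h, hc] at key
      have key' := char_orthonormal ρ' ρ'
      rw [← charInner_eq, key, if_pos ⟨Representation.Equiv.refl ρ'⟩] at key'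
      exact zero_ne_one key'

lemma charInner_self_of_mem_Irr {χ : G → ℂ} (hχ : χ ∈ Irr G) : charInner χ χ = 1 := by
  classical
  rw [charInner_of_mem_Irr hχ hχ, if_pos rfl]

lemma charInner_eq_zero_of_ne {χ χ' : G → ℂ} (hχ : χ ∈ Irr G) (hχ' : χ' ∈ Irr G)
    (h : χ ≠ χ') : charInner χ χ' = 0 := by
  classical
  rw [charInner_of_mem_Irr hχ hχ', if_neg h]

/-- The inner product of two characters is a natural number. -/
lemma charInner_character_eq_natCast {V W : Type*} [AddCommGroup V] [Module ℂ V]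
    [FiniteDimensional ℂ V] [AddCommGroup W] [Module ℂ W] [FiniteDimensional ℂ W]
    (ρ : Representation ℂ G V) (σ : Representation ℂ G W) :
    ∃ m : ℕ, charInner ρ.character σ.character = m := by
  have := Fintype.ofFinite G
  have : Invertible (Nat.card G : ℂ) :=
    invertibleOfNonzero (Nat.cast_ne_zero.2 Nat.card_pos.ne')
  exact ⟨_, by rw [charInner_eq, card_inv_mul_sum_char_mul_char_eq_finrank]⟩

/-- Orthonormality makes the irreducible characters linearly independent in the finite-dimensional
space of functions on G. -/
lemma finite_Irr (G : Type*) [Group G] [Finite G] : (Irr G).Finite := by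
  have hli : LinearIndependent ℂ (fun χ : Irr G => (χ : G → ℂ)) := by
    rw [linearIndependent_iff']
    intro s c hc χ hχ
    have h := congrArg (fun f => charInner f (χ : G → ℂ)) hc
    simp only [charInner_sum_left] at h
    rw [Finset.sum_eq_single χ, charInner_self_of_mem_Irr χ.2, mul_one] at h
    · rw [h]
      simp [charInner]
    · intro χ' _ hne
      rw [charInner_eq_zero_of_ne χ'.2 χ.2 fun h => hne (Subtype.ext h), mul_zero]
    · exact fun h => absurd hχ h
  exact Set.finite_coe_iff.1 hli.finite

/-- A class function acts on an irreducible representation as a scalar. -/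
lemma exists_sum_smul_eq_smul_id [Fintype G] {f : G → ℂ} (hf : IsClassFun f)
    {V : Type*} [AddCommGroup V] [Module ℂ V] [FiniteDimensional ℂ V]
    (ρ : Representation ℂ G V) [ρ.IsIrreducible] :
    ∃ c : ℂ, ∑ g, f g⁻¹ • ρ g = c • LinearMap.id ∧
      c * Module.finrank ℂ V = Nat.card G * charInner ρ.character f := by
  obtain ⟨c, hc⟩ := exists_eq_smul_id_of_commute ρ (∑ g, f g⁻¹ • ρ g) fun x => by
    simp only [← Module.End.mul_eq_comp, Finset.sum_mul, Finset.mul_sum]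
    rw [← Equiv.sum_comp (MulAut.conj x).toEquiv]
    refine Finset.sum_congr rfl fun g _ => ?_
    have h1 : f (x * g * x⁻¹)⁻¹ = f g⁻¹ := by
      simpa [mul_assoc] using hf x⁻¹ g⁻¹
    have h2 : ρ (x * g * x⁻¹) * ρ x = ρ x * ρ g := by
      simp only [← map_mul, inv_mul_cancel_right]
    change f (x * g * x⁻¹)⁻¹ • ρ (x * g * x⁻¹) * ρ x = ρ x * f g⁻¹ • ρ g
    rw [h1, smul_mul_assoc, mul_smul_comm, h2]
  refine ⟨c, hc, ?_⟩
  have htr := congrArg (LinearMap.trace ℂ V) hc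
  have hn : (Nat.card G : ℂ) ≠ 0 := Nat.cast_ne_zero.2 Nat.card_pos.ne'
  rw [charInner_eq, mul_inv_cancel_left₀ hn]
  simpa [character, mul_comm] using htr.symm

/-- A class function acts on an irreducible representation to which it is orthogonal as zero. -/
lemma sum_smul_eq_zero_of_charInner_eq_zero [Fintype G] {f : G → ℂ} (hf : IsClassFun f)
    {V : Type*} [AddCommGroup V] [Module ℂ V] [FiniteDimensional ℂ V]
    (ρ : Representation ℂ G V) [ρ.IsIrreducible] (h : charInner ρ.character f = 0) :
    ∑ g, f g⁻¹ • ρ g = 0 := by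
  obtain ⟨c, hc, h0⟩ := exists_sum_smul_eq_smul_id hf ρ
  rw [h, mul_zero] at h0
  rw [hc]
  rcases mul_eq_zero.1 h0 with h1 | h1
  · rw [h1, zero_smul]
  · have := Module.finrank_zero_iff.1 (Nat.cast_eq_zero.1 h1)
    exact Subsingleton.elim _ _

/-- If right multiplication by `m` scales a class function `f` by `c`, then `m` acts as `c` in
the irreducible constituents of `f`. -/
lemma apply_mul_of_charInner_ne_zero {f χ : G → ℂ} (hf : IsClassFun f) (hχ : χ ∈ Irr G)
    (h : charInner χ f ≠ 0) {m : G} {c : ℂ} (hm : ∀ g, f (g * m) = c * f g) (g : G) :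
    χ (m * g) = c * χ g := by
  have := Fintype.ofFinite G
  obtain ⟨d, ρ, hρ, rfl⟩ := hχ
  obtain ⟨a, ha, ha'⟩ := exists_sum_smul_eq_smul_id hf ρ
  have ha0 : a ≠ 0 := by
    rintro rfl
    rw [zero_mul] at ha'
    exact mul_ne_zero (Nat.cast_ne_zero.2 Nat.card_pos.ne') h ha'.symm
  -- The averaged operator is the scalar a, nonzero because χ is a constituent of f. Translating the
  -- summation variable by m shows that ρ(m) scales it by c; cancelling a leaves ρ(m) = c.
  have key : ρ m * ∑ g, f g⁻¹ • ρ g = c • ∑ g, f g⁻¹ • ρ g := by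
    rw [Finset.mul_sum, Finset.smul_sum, ← Equiv.sum_comp (Equiv.mulLeft m⁻¹)]
    refine Finset.sum_congr rfl fun g _ => ?_
    rw [mul_smul_comm, ← map_mul, Equiv.coe_mulLeft, mul_inv_cancel_left, mul_inv_rev, inv_inv,
      hm, mul_smul]
  rw [ha] at key
  have hρm : ρ m = c • LinearMap.id := by
    refine smul_right_injective _ ha0 ?_
    change a • ρ m = a • c • LinearMap.id
    rw [smul_comm a c, ← key, mul_smul_comm]
    rfl
  rw [character, map_mul, hρm, character]
  change LinearMap.trace ℂ _ ((c • (1 : Module.End ℂ (Fin d → ℂ))) * ρ g) = _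
  rw [smul_mul_assoc, one_mul, map_smul, smul_eq_mul]

/-- A class function orthogonal to all irreducible characters acts on a simple module as zero. -/
lemma sum_single_smul_eq_zero [Fintype G] {f : G → ℂ} (hf : IsClassFun f)
    (h : ∀ χ ∈ Irr G, charInner χ f = 0) (M : Type*) [AddCommGroup M] [Module ℂ M]
    [Module ℂ[G] M] [IsScalarTower ℂ ℂ[G] M] [hM : IsSimpleModule ℂ[G] M] (v : M) :
    (∑ g, MonoidAlgebra.single g (f g⁻¹) : ℂ[G]) • v = 0 := by
  have hρ : (ofModule' (k := ℂ) (G := G) M).asAlgebraHom = Algebra.lsmul ℂ ℂ M :=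
    Equiv.apply_symm_apply _ _
  let e : (ofModule' (k := ℂ) (G := G) M).asModule ≃ₗ[ℂ[G]] M :=
    { (ofModule' (k := ℂ) (G := G) M).asModuleEquiv.toAddEquiv with
      map_smul' := fun r x => by
        change (ofModule' (k := ℂ) (G := G) M).asModuleEquiv (r • x) = _
        rw [asModuleEquiv_map_smul, hρ]
        rfl }
  have : Representation.IsIrreducible (ofModule' (k := ℂ) (G := G) M) := by
    rw [irreducible_iff_isSimpleModule_asModule]
    exact IsSimpleModule.congr e
  have : FiniteDimensional ℂ M := Module.Finite.trans ℂ[G] _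
  have h0 := sum_smul_eq_zero_of_charInner_eq_zero hf (ofModule' (k := ℂ) (G := G) M)
    (h _ (character_mem_Irr _))
  have h1 : (ofModule' (k := ℂ) (G := G) M).asAlgebraHom
      (∑ g, MonoidAlgebra.single g (f g⁻¹)) = 0 := by
    rw [← h0]
    simp only [map_sum, asAlgebraHom_single]
  rw [hρ] at h1
  exact LinearMap.congr_fun h1 v

/-- A class function orthogonal to all irreducible characters vanishes. -/
lemma eq_zero_of_charInner_eq_zero {f : G → ℂ} (hf : IsClassFun f)
    (h : ∀ χ ∈ Irr G, charInner χ f = 0) : f = 0 := by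
  have := Fintype.ofFinite G
  have : NeZero (Nat.card G : ℂ) := ⟨Nat.cast_ne_zero.2 Nat.card_pos.ne'⟩
  -- z kills every simple left ideal. By Maschke's theorem these span ℂ[G], so z = z · 1 = 0, and
  -- the coefficients of z are the values of f.
  let z : ℂ[G] := ∑ g, MonoidAlgebra.single g (f g⁻¹)
  have hS : ∀ S : Submodule ℂ[G] ℂ[G], IsSimpleModule ℂ[G] S → ∀ v ∈ S, z * v = 0 := by
    intro S hS v hv
    have := sum_single_smul_eq_zero hf h S ⟨v, hv⟩
    simpa using congrArg Subtype.val this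
  have htop : ∀ v : ℂ[G], z * v = 0 := by
    intro v
    have hv : v ∈ sSup {S : Submodule ℂ[G] ℂ[G] | IsSimpleModule ℂ[G] S} := by
      rw [IsSemisimpleModule.sSup_simples_eq_top]
      exact Submodule.mem_top
    rw [sSup_eq_iSup'] at hv
    induction hv using Submodule.iSup_induction' with
    | mem S v hv => exact hS S S.2 v hv
    | zero => exact mul_zero z
    | add v w _ _ hv hw => rw [mul_add, hv, hw, add_zero]
  have hz : z = 0 := by simpa using htop 1
  funext g
  have := congrArg (fun w : ℂ[G] => w.coeff g⁻¹) hz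
  classical
  simpa [z, Finsupp.single_apply] using this

/-- A class function is the combination of the irreducible characters given by its inner
products with them. -/
lemma eq_sum_charInner_smul {f : G → ℂ} (hf : IsClassFun f) :
    f = ∑ χ ∈ (finite_Irr G).toFinset, charInner χ f • χ := by
  rw [← sub_eq_zero]
  refine eq_zero_of_charInner_eq_zero ?_ fun χ hχ => ?_
  · intro x g
    simp only [Pi.sub_apply, Finset.sum_apply, Pi.smul_apply]
    rw [hf]
    congr 1
    refine Finset.sum_congr rfl fun χ hχ => ?_
    rw [isClassFun_of_mem_Irr ((finite_Irr G).mem_toFinset.1 hχ)]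
  · rw [charInner_comm, charInner_sub_left,
      charInner_sum_left _ (fun χ => charInner χ f) (fun χ => χ),
      Finset.sum_eq_single χ, charInner_self_of_mem_Irr hχ, mul_one, charInner_comm, sub_self]
    · intro χ' hχ' hne
      rw [charInner_eq_zero_of_ne ((finite_Irr G).mem_toFinset.1 hχ') hχ hne, mul_zero]
    · exact fun h => absurd ((finite_Irr G).mem_toFinset.2 hχ) h

/-- A class function of norm one whose inner products with the irreducible characters are
natural numbers is an irreducible character. -/
lemma mem_Irr_of_charInner {f : G → ℂ} (hf : IsClassFun f) (h1 : charInner f f = 1)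
    (hnat : ∀ χ ∈ Irr G, ∃ m : ℕ, charInner χ f = m) : f ∈ Irr G := by
  classical
  have hmem := fun χ => (finite_Irr G).mem_toFinset (a := χ)
  choose! m hm using hnat
  have hf' := eq_sum_charInner_smul hf
  -- Norm one says that the squares of the multiplicities sum to 1. As they are natural numbers,
  -- exactly one multiplicity is 1 and the others vanish.
  have hsum : ∑ χ ∈ (finite_Irr G).toFinset, m χ * m χ = 1 := by
    have : charInner (∑ χ ∈ (finite_Irr G).toFinset, charInner χ f • χ) f = 1 := by
      rw [← hf', h1]
    rw [charInner_sum_left _ (fun χ => charInner χ f) (fun χ => χ)] at this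
    have h2 : ∑ χ ∈ (finite_Irr G).toFinset, ((m χ : ℂ) * m χ) = 1 := by
      rw [← this]
      exact Finset.sum_congr rfl fun χ hχ => by rw [hm χ ((hmem χ).1 hχ)]
    exact_mod_cast h2
  obtain ⟨χ, hχ, hne⟩ : ∃ χ ∈ (finite_Irr G).toFinset, m χ * m χ ≠ 0 :=
    Finset.exists_ne_zero_of_sum_ne_zero (by rw [hsum]; exact one_ne_zero)
  rw [← Finset.add_sum_erase _ _ hχ] at hsum
  have hχ1 : m χ = 1 := by
    have : m χ * m χ = 1 := by omega
    exact Nat.eq_one_of_mul_eq_one_right this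
  have hrest : ∀ χ' ∈ (finite_Irr G).toFinset.erase χ, m χ' = 0 := by
    intro χ' hχ'
    have : ∑ χ ∈ (finite_Irr G).toFinset.erase χ, m χ * m χ = 0 := by
      rw [hχ1] at hsum; omega
    exact mul_self_eq_zero.1 (Finset.sum_eq_zero_iff.1 this χ' hχ')
  have : f = χ := by
    rw [hf', ← Finset.add_sum_erase _ _ hχ, hm χ ((hmem χ).1 hχ), hχ1, Nat.cast_one, one_smul,
      Finset.sum_eq_zero, add_zero]
    intro χ' hχ'
    rw [hm χ' ((hmem χ').1 (Finset.mem_of_mem_erase hχ')), hrest χ' hχ', Nat.cast_zero, zero_smul]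
  rw [this]
  exact (hmem χ).1 hχ

end Finite

end CharacterTheory

/-! ### Induced characters -/

section Induction

variable {G : Type*} [Group G]

open Classical in
/-- The extension by zero of a function on a subgroup. -/
def extendZero (H : Subgroup G) (f : H → ℂ) (g : G) : ℂ :=
  if h : g ∈ H then f ⟨g, h⟩ else 0

lemma extendZero_of_mem {H : Subgroup G} (f : H → ℂ) {g : G} (h : g ∈ H) :
    extendZero H f g = f ⟨g, h⟩ := dif_pos h

lemma extendZero_of_notMem {H : Subgroup G} (f : H → ℂ) {g : G} (h : g ∉ H) :
    extendZero H f g = 0 := dif_neg h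

lemma extendZero_coe {H : Subgroup G} (f : H → ℂ) (h : H) : extendZero H f h = f h :=
  extendZero_of_mem f h.2

/-- A property of the values of a function on `H` relative to right multiplication by an element
of `H` extends to its extension by zero. -/
lemma extendZero_mul_right {H : Subgroup G} {f : H → ℂ} {m : H} {c : ℂ}
    (hm : ∀ h, f (h * m) = c * f h) (g : G) :
    extendZero H f (g * m) = c * extendZero H f g := by
  by_cases hg : g ∈ H
  · rw [extendZero_of_mem f hg, extendZero_of_mem f (mul_mem hg m.2), ← hm]
    rfl
  · rw [extendZero_of_notMem f hg, extendZero_of_notMem, mul_zero]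
    rwa [Subgroup.mul_mem_cancel_right _ m.2]

variable {N H K : Subgroup G}

lemma sum_extendZero_mul [Fintype H] [Fintype K] (hHK : H ≤ K) (f : H → ℂ) (F : K → ℂ) :
    ∑ x : K, extendZero H f x * F x = ∑ h : H, f h * F (Subgroup.inclusion hHK h) := by
  symm
  refine Finset.sum_of_injOn (Subgroup.inclusion hHK)
    (Subgroup.inclusion_injective hHK).injOn (by simp) ?_ ?_
  · intro x _ hx
    rw [extendZero_of_notMem, zero_mul]
    intro hxH
    exact hx ⟨⟨x, hxH⟩, by simp, rfl⟩
  · intro h _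
    rw [Subgroup.coe_inclusion, extendZero_coe]

variable [Finite G]

lemma induce_apply [Fintype K] (f : H → ℂ) (k : K) :
    induce H K f k = (Nat.card H : ℂ)⁻¹ * ∑ x : K, extendZero H f ((x : G)⁻¹ * k * x) := by
  rw [induce, finsum_eq_sum_of_fintype]
  rfl

lemma isClassFun_induce (f : H → ℂ) : IsClassFun (induce H K f) := by
  have := Fintype.ofFinite K
  intro x g
  rw [induce_apply, induce_apply, ← Equiv.sum_comp (Equiv.mulLeft x) fun y : K =>
    extendZero H f ((y : G)⁻¹ * g * y)]
  congr 1
  exact Finset.sum_congr rfl fun y _ => by congr 1; simp [mul_assoc]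

lemma induce_sum {ι : Type*} (s : Finset ι) (c : ι → ℂ) (f : ι → H → ℂ) :
    induce H K (∑ i ∈ s, c i • f i) = ∑ i ∈ s, c i • induce H K (f i) := by
  have := Fintype.ofFinite K
  funext k
  have hext : ∀ g, extendZero H (∑ i ∈ s, c i • f i) g = ∑ i ∈ s, c i * extendZero H (f i) g := by
    intro g
    by_cases hg : g ∈ H
    · simp [extendZero_of_mem _ hg]
    · simp [extendZero_of_notMem _ hg]
  simp only [Finset.sum_apply, Pi.smul_apply, induce_apply, smul_eq_mul, hext, Finset.mul_sum]
  rw [Finset.sum_comm]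
  exact Finset.sum_congr rfl fun i _ => Finset.sum_congr rfl fun x _ => by ring

/-- Frobenius reciprocity. -/
lemma charInner_induce_left (hHK : H ≤ K) (f : H → ℂ) {τ : K → ℂ} (hτ : IsClassFun τ) :
    charInner (induce H K f) τ = charInner f (τ ∘ Subgroup.inclusion hHK) := by
  have := Fintype.ofFinite K
  have := Fintype.ofFinite H
  have hK : (Nat.card K : ℂ) ≠ 0 := Nat.cast_ne_zero.2 Nat.card_pos.ne'
  -- Substituting k ↦ x k x⁻¹ removes x from the inner sum because τ is a class function; the
  -- average over x is then trivial.
  have h1 : ∀ x : K, ∑ k : K, extendZero H f ((x : G)⁻¹ * k * x) * τ k⁻¹ =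
      ∑ h : H, f h * τ (Subgroup.inclusion hHK h)⁻¹ := by
    intro x
    rw [← sum_extendZero_mul hHK f fun k => τ k⁻¹, ← Equiv.sum_comp (MulAut.conj x).toEquiv]
    refine Finset.sum_congr rfl fun k _ => ?_
    congr 1
    · congr 1
      simp [mul_assoc]
    · simpa [mul_assoc] using hτ x⁻¹ k⁻¹
  rw [charInner_eq, charInner_eq]
  have h2 : ∑ k : K, induce H K f k * τ k⁻¹ = (Nat.card H : ℂ)⁻¹ *
      ∑ x : K, ∑ k : K, extendZero H f ((x : G)⁻¹ * k * x) * τ k⁻¹ := by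
    rw [Finset.sum_comm, Finset.mul_sum]
    exact Finset.sum_congr rfl fun k _ => by rw [induce_apply, mul_assoc, Finset.sum_mul]
  rw [h2, Finset.sum_congr rfl fun x _ => h1 x, Finset.sum_const, Finset.card_univ,
    ← Nat.card_eq_fintype_card, nsmul_eq_mul, mul_left_comm _ (Nat.card K : ℂ),
    inv_mul_cancel_left₀ hK]
  rfl

/-- Transitivity of induction. -/
lemma induce_induce (hHK : H ≤ K) (hNH : N ≤ H) (f : N → ℂ) :
    induce H K (induce N H f) = induce N K f := by
  have := Fintype.ofFinite K
  have := Fintype.ofFinite H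
  have hH : (Nat.card H : ℂ) ≠ 0 := Nat.cast_ne_zero.2 Nat.card_pos.ne'
  have hext : ∀ g, extendZero H (induce N H f) g =
      (Nat.card N : ℂ)⁻¹ * ∑ x : H, extendZero N f ((x : G)⁻¹ * g * x) := by
    intro g
    by_cases hg : g ∈ H
    · rw [extendZero_of_mem _ hg, induce_apply]
    · rw [extendZero_of_notMem _ hg, Finset.sum_eq_zero, mul_zero]
      intro x _
      refine extendZero_of_notMem _ fun h => hg ?_
      have := mul_mem (mul_mem x.2 (hNH h)) (inv_mem x.2)
      simpa [mul_assoc] using this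
  funext k
  simp only [induce_apply, hext, ← Finset.mul_sum]
  rw [Finset.sum_comm, Finset.sum_congr rfl (g := fun _ =>
    ∑ y : K, extendZero N f ((y : G)⁻¹ * k * y)), Finset.sum_const, Finset.card_univ,
    ← Nat.card_eq_fintype_card, nsmul_eq_mul, mul_left_comm _ (Nat.card H : ℂ),
    inv_mul_cancel_left₀ hH]
  intro x _
  -- The substitution y ↦ y x absorbs the conjugation by x ∈ H, so all |H| inner sums agree.
  rw [← Equiv.sum_comp (Equiv.mulRight (Subgroup.inclusion hHK x)) fun y : K =>
    extendZero N f ((y : G)⁻¹ * k * y)]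
  exact Finset.sum_congr rfl fun y _ => by congr 1; simp [mul_assoc]

/-! ### Characters over an invariant linear character -/

/-- A linear character `l` of `N` is invariant under `H` if `H` normalizes `N` and conjugation by
`H` preserves `l`. -/
def IsInvariantChar (N H : Subgroup G) (l : N →* ℂ) : Prop :=
  ∀ h ∈ H, ∀ n (hn : n ∈ N), ∃ hn' : h * n * h⁻¹ ∈ N, l ⟨h * n * h⁻¹, hn'⟩ = l ⟨n, hn⟩

/-- `x` intertwines the linear character `l` of `N`. -/
def Intertwines {N : Subgroup G} (l : N →* ℂ) (x : G) : Prop :=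
  ∀ n (hn : n ∈ N) (hn' : x⁻¹ * n * x ∈ N), l ⟨n, hn⟩ = l ⟨x⁻¹ * n * x, hn'⟩

/-- `H` contains all elements of `K` that intertwine the linear character `l` of `N`. -/
def ContainsIntertwiners (N H K : Subgroup G) (l : N →* ℂ) : Prop :=
  ∀ x ∈ K, Intertwines l x → x ∈ H

variable {l : N →* ℂ}

/-- Elements of `N` act by `l` in the constituents of `l^H`, if `l` is `H`-invariant. -/
lemma apply_mul_of_mem_IrrOver (hNH : N ≤ H) (hinv : IsInvariantChar N H l) {χ : H → ℂ}
    (hχ : χ ∈ IrrOver N H l) (n : N) (h : H) :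
    χ (Subgroup.inclusion hNH n * h) = l n * χ h := by
  have := Fintype.ofFinite H
  refine apply_mul_of_charInner_ne_zero (m := Subgroup.inclusion hNH n) (c := l n)
    (isClassFun_induce _) hχ.1 hχ.2 (fun g => ?_) h
  rw [induce_apply, induce_apply, mul_left_comm]
  congr 1
  rw [Finset.mul_sum]
  refine Finset.sum_congr rfl fun x _ => ?_
  obtain ⟨hm, hl⟩ := hinv (x : G)⁻¹ (inv_mem x.2) n n.2
  have h1 := extendZero_mul_right (f := (l : N → ℂ)) (m := ⟨_, hm⟩) (c := l n)
    (fun n' => by rw [map_mul, hl, mul_comm]) ((x : G)⁻¹ * g * x)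
  rw [← h1]
  congr 1
  simp [mul_assoc]

/-- By Frobenius reciprocity this is an inner product over N, where χ restricts to χ(1) times l, so
every term of the average equals χ(1). -/
lemma charInner_induce_of_mem_IrrOver (hNH : N ≤ H) (hinv : IsInvariantChar N H l) {χ : H → ℂ}
    (hχ : χ ∈ IrrOver N H l) : charInner χ (induce N H l) = χ 1 := by
  have := Fintype.ofFinite N
  rw [charInner_comm, charInner_induce_left hNH _ (isClassFun_of_mem_Irr hχ.1), charInner_eq]
  have hval : ∀ n : N, l n * (χ ∘ Subgroup.inclusion hNH) n⁻¹ = χ 1 := by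
    intro n
    have := apply_mul_of_mem_IrrOver hNH hinv hχ n⁻¹ 1
    rw [mul_one] at this
    rw [Function.comp_apply, this, ← mul_assoc, ← map_mul, mul_inv_cancel, map_one, one_mul]
  rw [Finset.sum_congr rfl fun n _ => hval n, Finset.sum_const, Finset.card_univ,
    ← Nat.card_eq_fintype_card, nsmul_eq_mul, inv_mul_cancel_left₀]
  exact Nat.cast_ne_zero.2 Nat.card_pos.ne'

/-- Mackey's formula, when only elements of `H` intertwine. -/
lemma charInner_induce_induce (hNH : N ≤ H) (hHK : H ≤ K)
    (hint : ContainsIntertwiners N H K l) {χ₁ χ₂ : H → ℂ} (hχ₂ : IsClassFun χ₂)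
    (h₁ : ∀ (n : N) h, χ₁ (Subgroup.inclusion hNH n * h) = l n * χ₁ h)
    (h₂ : ∀ (n : N) h, χ₂ (Subgroup.inclusion hNH n * h) = l n * χ₂ h) :
    charInner (induce H K χ₁) (induce H K χ₂) = charInner χ₁ χ₂ := by
  classical
  have := Fintype.ofFinite K
  have := Fintype.ofFinite H
  have hH : (Nat.card H : ℂ) ≠ 0 := Nat.cast_ne_zero.2 Nat.card_pos.ne'
  have key : ∀ x : K, ∑ h : H, χ₁ h * extendZero H χ₂ ((x : G)⁻¹ * (h : G)⁻¹ * x) =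
      extendZero H (fun _ => 1) x * ∑ h : H, χ₁ h * χ₂ h⁻¹ := by
    intro x
    by_cases hx : (x : G) ∈ H
    · rw [extendZero_of_mem _ hx, one_mul]
      refine Finset.sum_congr rfl fun h _ => ?_
      rw [← hχ₂ ⟨x, hx⟩ h⁻¹, ← extendZero_coe χ₂]
      rfl
    · rw [extendZero_of_notMem _ hx, zero_mul]
      -- For x outside H some n has l(n) ≠ l(x⁻¹nx). The shift h ↦ n h multiplies the sum by l(n)
      -- l(x⁻¹nx)⁻¹ ≠ 1, so the sum is zero.
      have := mt (hint x x.2) hx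
      unfold Intertwines at this
      push Not at this
      obtain ⟨n, hn, hn', hne⟩ := this
      let m : N := ⟨_, hn'⟩
      have h3 : ∀ g, extendZero H χ₂ (g * (Subgroup.inclusion hNH m⁻¹ : H)) =
          l m⁻¹ * extendZero H χ₂ g := by
        refine extendZero_mul_right fun h => ?_
        rw [← h₂, ← hχ₂ (Subgroup.inclusion hNH m⁻¹) (_ * h), mul_assoc, mul_assoc,
          inv_mul_cancel_left]
      have h4 : ∑ h : H, χ₁ h * extendZero H χ₂ ((x : G)⁻¹ * (h : G)⁻¹ * x) = l ⟨n, hn⟩ * l m⁻¹ *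
          ∑ h : H, χ₁ h * extendZero H χ₂ ((x : G)⁻¹ * (h : G)⁻¹ * x) := by
        conv_lhs => rw [← Equiv.sum_comp (Equiv.mulLeft (Subgroup.inclusion hNH ⟨n, hn⟩))]
        rw [Finset.mul_sum]
        refine Finset.sum_congr rfl fun h _ => ?_
        rw [Equiv.coe_mulLeft, h₁, mul_mul_mul_comm, ← h3]
        congr 2
        simp [m, mul_assoc]
      have h5 : l ⟨n, hn⟩ * l m⁻¹ ≠ 1 := by
        intro h6
        apply hne
        have h7 : l m⁻¹ * l m = 1 := by rw [← map_mul, inv_mul_cancel, map_one]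
        calc l ⟨n, hn⟩ = l ⟨n, hn⟩ * (l m⁻¹ * l m) := by rw [h7, mul_one]
          _ = l m := by rw [← mul_assoc, h6, one_mul]
      by_contra h0
      exact h5 (mul_right_cancel₀ h0 (by rw [one_mul]; exact h4.symm))
  rw [charInner_induce_left hHK _ (isClassFun_induce _), charInner_eq, charInner_eq]
  have h6 : ∑ x : K, extendZero H (fun _ => 1) (x : G) = Nat.card H := by
    have := sum_extendZero_mul hHK (fun _ => 1) fun _ => 1
    simpa [Nat.card_eq_fintype_card] using this
  congr 1
  simp only [Function.comp_apply, induce_apply, Finset.mul_sum, mul_left_comm (χ₁ _)]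
  rw [Finset.sum_comm]
  simp only [← Finset.mul_sum]
  have h7 : ∀ x : K, ∑ h : H, χ₁ h * extendZero H χ₂ ((x : G)⁻¹ *
      ((Subgroup.inclusion hHK h⁻¹ : K) : G) * x) =
      extendZero H (fun _ => 1) x * ∑ h : H, χ₁ h * χ₂ h⁻¹ := by
    intro x
    rw [← key]
    rfl
  simp only [h7]
  rw [← Finset.sum_mul, h6, inv_mul_cancel_left₀ hH]


lemma finite_IrrOver (f : N → ℂ) : (IrrOver N H f).Finite :=
  (finite_Irr H).subset fun _ h => h.1

/-- The decomposition of the character induced by an invariant linear character. -/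
lemma induce_eq_sum_IrrOver (hNH : N ≤ H) (hinv : IsInvariantChar N H l) :
    induce N H l = ∑ χ ∈ (finite_IrrOver (H := H) (l : N → ℂ)).toFinset, χ 1 • χ := by
  rw [eq_sum_charInner_smul (isClassFun_induce (K := H) (l : N → ℂ))]
  classical
  symm
  refine Finset.sum_subset_zero_on_sdiff ?_ ?_ ?_
  · intro χ hχ
    rw [Set.Finite.mem_toFinset] at hχ ⊢
    exact hχ.1
  · intro χ hχ
    rw [Finset.mem_sdiff, Set.Finite.mem_toFinset, Set.Finite.mem_toFinset] at hχ
    have : charInner χ (induce N H l) = 0 := by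
      by_contra h
      exact hχ.2 ⟨hχ.1, h⟩
    rw [this, zero_smul]
  · intro χ hχ
    rw [charInner_induce_of_mem_IrrOver hNH hinv ((Set.Finite.mem_toFinset _).1 hχ)]

lemma induce_eq_sum_induce (hNH : N ≤ H) (hHK : H ≤ K)
    (hinv : IsInvariantChar N H l) :
    induce N K l =
      ∑ χ ∈ (finite_IrrOver (H := H) (l : N → ℂ)).toFinset, χ 1 • induce H K χ := by
  rw [← induce_induce hHK hNH, induce_eq_sum_IrrOver hNH hinv,
    induce_sum _ (fun χ => χ 1) (fun χ => χ)]

lemma charInner_induce_of_mem (hNH : N ≤ H) (hHK : H ≤ K)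
    (hinv : IsInvariantChar N H l) (hint : ContainsIntertwiners N H K l)
    {χ₁ χ₂ : H → ℂ} (h₁ : χ₁ ∈ IrrOver N H l)
    (h₂ : χ₂ ∈ IrrOver N H l) :
    charInner (induce H K χ₁) (induce H K χ₂) = charInner χ₁ χ₂ :=
  charInner_induce_induce hNH hHK hint (isClassFun_of_mem_Irr h₂.1)
    (apply_mul_of_mem_IrrOver hNH hinv h₁) (apply_mul_of_mem_IrrOver hNH hinv h₂)

/-- Mackey's formula gives norm one. The multiplicities are natural numbers since, by Frobenius
reciprocity, they are inner products of χ with restricted characters. -/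
lemma induce_mem_Irr (hNH : N ≤ H) (hHK : H ≤ K)
    (hinv : IsInvariantChar N H l) (hint : ContainsIntertwiners N H K l)
    {χ : H → ℂ} (hχ : χ ∈ IrrOver N H l) : induce H K χ ∈ Irr K := by
  refine mem_Irr_of_charInner (isClassFun_induce _) ?_ fun τ hτ => ?_
  · rw [charInner_induce_of_mem hNH hHK hinv hint hχ hχ, charInner_self_of_mem_Irr hχ.1]
  · rw [charInner_comm, charInner_induce_left hHK _ (isClassFun_of_mem_Irr hτ)]
    obtain ⟨d, ρ, -, rfl⟩ := hχ.1
    obtain ⟨d', σ, -, rfl⟩ := hτ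
    exact charInner_character_eq_natCast ρ (σ.comp (Subgroup.inclusion hHK))

lemma charInner_induce_eq_apply_one (hNH : N ≤ H) (hHK : H ≤ K)
    (hinv : IsInvariantChar N H l) (hint : ContainsIntertwiners N H K l)
    {χ : H → ℂ} (hχ : χ ∈ IrrOver N H l) :
    charInner (induce N K l) (induce H K χ) = χ 1 := by
  rw [induce_eq_sum_induce hNH hHK hinv,
    charInner_sum_left _ (fun χ : H → ℂ => χ 1) (fun χ => induce H K χ), Finset.sum_eq_single χ,
    charInner_induce_of_mem hNH hHK hinv hint hχ hχ, charInner_self_of_mem_Irr hχ.1, mul_one]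
  · intro χ' hχ' hne
    rw [Set.Finite.mem_toFinset] at hχ'
    rw [charInner_induce_of_mem hNH hHK hinv hint hχ' hχ,
      charInner_eq_zero_of_ne hχ'.1 hχ.1 hne, mul_zero]
  · exact fun h => absurd ((Set.Finite.mem_toFinset _).2 hχ) h

/-- The constituents of `l^K` are the characters induced by the constituents of `l^H`. -/
lemma constituents_induce (hNH : N ≤ H) (hHK : H ≤ K)
    (hinv : IsInvariantChar N H l) (hint : ContainsIntertwiners N H K l) :
    constituents (induce N K l) = induce H K '' IrrOver N H l := by
  ext τ
  constructor
  · rintro ⟨hτ, hne⟩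
    rw [induce_eq_sum_induce hNH hHK hinv,
      charInner_sum_right _ (fun χ : H → ℂ => χ 1) (fun χ => induce H K χ)] at hne
    obtain ⟨χ, hχ, hχne⟩ := Finset.exists_ne_zero_of_sum_ne_zero hne
    rw [Set.Finite.mem_toFinset] at hχ
    refine ⟨χ, hχ, ?_⟩
    by_contra h
    rw [charInner_eq_zero_of_ne hτ (induce_mem_Irr hNH hHK hinv hint hχ) (Ne.symm h),
      mul_zero] at hχne
    exact hχne rfl
  · rintro ⟨χ, hχ, rfl⟩
    refine ⟨induce_mem_Irr hNH hHK hinv hint hχ, ?_⟩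
    rw [charInner_comm, charInner_induce_eq_apply_one hNH hHK hinv hint hχ,
      ← charInner_induce_of_mem_IrrOver hNH hinv hχ]
    exact hχ.2

end Induction

/-! ### Products of induced characters -/

section Product

variable {G : Type*} [Group G] {ι : Type*} [Fintype ι]

lemma extendZero_iInf (H : ι → Subgroup G) (l : ∀ i, H i →* ℂ) (g : G) :
    extendZero (⨅ i, H i)
      (∏ i, (l i).comp (Subgroup.inclusion (iInf_le H i)) : (⨅ i, H i : Subgroup G) →* ℂ) g =
      ∏ i, extendZero (H i) (l i) g := by
  by_cases hg : g ∈ ⨅ i, H i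
  · rw [extendZero_of_mem _ hg, MonoidHom.finsetProd_apply]
    refine Finset.prod_congr rfl fun i _ => ?_
    rw [extendZero_of_mem _ (iInf_le H i hg)]
    rfl
  · rw [extendZero_of_notMem _ hg]
    rw [Subgroup.mem_iInf, not_forall] at hg
    obtain ⟨i, hi⟩ := hg
    exact (Finset.prod_eq_zero (Finset.mem_univ i) (extendZero_of_notMem (l i) hi)).symm

/-- If the diagonal map from `K` to the product of the coset spaces `K / H i` is surjective, the
product of the characters of `K` induced by linear characters `l i` of the `H i` is induced by
the product of the `l i` on the intersection of the `H i`. -/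
lemma prod_induce [Finite G] {K : Subgroup G} (H : ι → Subgroup G) (l : ∀ i, H i →* ℂ)
    (hHK : ∀ i, H i ≤ K) (hK : ⨅ i, H i ≤ K)
    (hdiag : ∀ y : ι → K, ∃ x : K, ∀ i, ((x : G)⁻¹ * y i : G) ∈ H i) :
    ∏ i, induce (H i) K (l i) = induce (⨅ i, H i) K
      (∏ i, (l i).comp (Subgroup.inclusion (iInf_le H i)) : (⨅ i, H i : Subgroup G) →* ℂ) := by
  classical
  have := Fintype.ofFinite K
  have := fun i => Fintype.ofFinite (H i)
  set N := ⨅ i, H i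
  have := Fintype.ofFinite N
  funext k
  let E : ι → K → ℂ := fun i x => extendZero (H i) (l i) ((x : G)⁻¹ * k * x)
  let e : ι → K → ℂ := fun i x => extendZero (H i) (fun _ => 1) (x : G)
  -- With e i the indicator function of H i, this says that E i is constant on the cosets x H i:
  -- conjugation by an element of H i does not change the linear character l i.
  have hE : ∀ i (x h : K), e i h * E i (x * h) = e i h * E i x := by
    intro i x h
    by_cases hh : (h : G) ∈ H i
    · congr 1
      have h1 := extendZero_mul_right (f := (l i : H i → ℂ)) (m := ⟨h, hh⟩) (c := l i ⟨h, hh⟩)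
        (fun n => by rw [map_mul, mul_comm]) ((h : G)⁻¹ * ((x : G)⁻¹ * k * x))
      have h2 : ∀ g : G, extendZero (H i) (l i) ((h : G)⁻¹ * g) =
          l i (⟨h, hh⟩⁻¹) * extendZero (H i) (l i) g := by
        intro g
        by_cases hg : g ∈ H i
        · rw [extendZero_of_mem _ hg, extendZero_of_mem _ (mul_mem (inv_mem hh) hg), ← map_mul]
          rfl
        · rw [extendZero_of_notMem _ hg, extendZero_of_notMem, mul_zero]
          rwa [Subgroup.mul_mem_cancel_left _ (inv_mem hh)]
      rw [h2, ← mul_assoc (l i _), ← map_mul, mul_inv_cancel, map_one, one_mul] at h1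
      simp only [E]
      rw [← h1]
      congr 1
      simp [mul_assoc]
    · simp only [e, extendZero_of_notMem _ hh, zero_mul]
  have he : ∀ x : K, ∏ i, e i x = extendZero N (fun _ => 1) (x : G) := by
    intro x
    have := extendZero_iInf H (fun _ => (1 : _ →* ℂ)) x
    simp only [e]
    refine Eq.trans ?_ (this.symm.trans ?_)
    · rfl
    · congr 1
      funext n
      simp
  -- The x lying in all the cosets y i H i form a single coset of N, nonempty by `hdiag`.
  have hcount : ∀ y : ι → K, ∑ x : K, ∏ i, e i (x⁻¹ * y i) = Nat.card N := by
    intro y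
    obtain ⟨x₀, hx₀⟩ := hdiag y
    have h1 : ∀ x : K, ∏ i, e i (x⁻¹ * y i) = extendZero N (fun _ => 1) ((x⁻¹ * x₀ : K) : G) := by
      intro x
      rw [← he]
      refine Finset.prod_congr rfl fun i _ => ?_
      have h2 : ((x⁻¹ * y i : K) : G) = ((x⁻¹ * x₀ : K) : G) * ((x₀ : G)⁻¹ * y i) := by
        simp [mul_assoc]
      have h3 := extendZero_mul_right (f := fun _ : H i => (1 : ℂ)) (m := ⟨_, hx₀ i⟩) (c := 1)
        (fun _ => (one_mul _).symm) ((x⁻¹ * x₀ : K) : G)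
      rw [one_mul] at h3
      simp only [e]
      rw [h2, ← h3]
    simp only [h1]
    refine (Equiv.sum_comp ((Equiv.inv K).trans (Equiv.mulRight x₀)) fun x : K =>
      extendZero N (fun _ => 1) (x : G)).trans ?_
    have := sum_extendZero_mul hK (fun _ => 1) fun _ => 1
    simpa [Nat.card_eq_fintype_card] using this
  have hsum : ∀ i, ∑ h : K, e i h = Nat.card (H i) := by
    intro i
    have := sum_extendZero_mul (hHK i) (fun _ => 1) fun _ => 1
    simpa [Nat.card_eq_fintype_card] using this
  -- Double counting of the pairs (x, y) with x⁻¹ y i ∈ H i for all i: each y has |N| partners x,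
  -- each x has ∏ |H i| partners y, and on such pairs E i (y i) = E i x.
  have hprod : (Nat.card N : ℂ) * ∏ i, ∑ y : K, E i y =
      (∏ i, (Nat.card (H i) : ℂ)) * ∑ x : K, ∏ i, E i x := by
    rw [Finset.prod_univ_sum, Fintype.piFinset_univ, Finset.mul_sum]
    calc ∑ y : ι → K, (Nat.card N : ℂ) * ∏ i, E i (y i)
        = ∑ y : ι → K, ∑ x : K, ∏ i, e i (x⁻¹ * y i) * E i (y i) := by
          refine Finset.sum_congr rfl fun y _ => ?_
          rw [← hcount y, Finset.sum_mul]
          exact Finset.sum_congr rfl fun x _ => Finset.prod_mul_distrib.symm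
      _ = ∑ x : K, ∏ i, ∑ y : K, e i (x⁻¹ * y) * E i y := by
          rw [Finset.sum_comm]
          refine Finset.sum_congr rfl fun x _ => ?_
          rw [Finset.prod_univ_sum, Fintype.piFinset_univ]
      _ = ∑ x : K, ∏ i, ((Nat.card (H i) : ℂ) * E i x) := by
          refine Finset.sum_congr rfl fun x _ => Finset.prod_congr rfl fun i _ => ?_
          rw [← hsum i, Finset.sum_mul, ← Equiv.sum_comp (Equiv.mulLeft x)]
          refine Finset.sum_congr rfl fun h _ => ?_
          rw [Equiv.coe_mulLeft, inv_mul_cancel_left, hE]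
      _ = _ := by
          rw [Finset.mul_sum]
          exact Finset.sum_congr rfl fun x _ => Finset.prod_mul_distrib
  have hN : (Nat.card N : ℂ) ≠ 0 := Nat.cast_ne_zero.2 Nat.card_pos.ne'
  have hH : ∏ i, (Nat.card (H i) : ℂ) ≠ 0 :=
    Finset.prod_ne_zero_iff.2 fun i _ => Nat.cast_ne_zero.2 Nat.card_pos.ne'
  rw [Finset.prod_apply, induce_apply]
  simp only [induce_apply, extendZero_iInf]
  rw [Finset.prod_mul_distrib, Finset.prod_inv_distrib, inv_mul_eq_iff_eq_mul₀ hH,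
    mul_left_comm, eq_inv_mul_iff_mul_eq₀ hN]
  exact hprod

end Product

/-! ### Matrices in `U_n(F)` and root subgroups -/

section Matrices

variable {n : ℕ} {F : Type*} [Field F]

lemma rootElt_apply (β : PosRoot n) (c : F) (i j : Fin n) :
    rootElt β c i j =
      (1 : Matrix (Fin n) (Fin n) F) i j + if β.row = i ∧ β.col = j then c else 0 := by
  simp [rootElt, Matrix.transvection, Matrix.single_apply]

lemma inv_rootElt (β : PosRoot n) (c : F) : (rootElt β c)⁻¹ = rootElt β (-c) :=
  Units.ext rfl

lemma rootElt_mul_apply (β : PosRoot n) (c : F) (g : GL (Fin n) F) (i j : Fin n) :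
    (rootElt β c * g) i j = g i j + if i = β.row then c * g β.col j else 0 := by
  rw [Units.val_mul]
  change (Matrix.transvection β.row β.col c * (g : Matrix (Fin n) (Fin n) F)) i j = _
  by_cases h : i = β.row
  · subst h
    rw [Matrix.transvection_mul_apply_same, if_pos rfl]
  · rw [Matrix.transvection_mul_apply_of_ne _ _ _ _ h, if_neg h, add_zero]

lemma mul_rootElt_apply (β : PosRoot n) (c : F) (g : GL (Fin n) F) (i j : Fin n) :
    (g * rootElt β c) i j = g i j + if j = β.col then c * g i β.row else 0 := by
  rw [Units.val_mul]
  change ((g : Matrix (Fin n) (Fin n) F) * Matrix.transvection β.row β.col c) i j = _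
  by_cases h : j = β.col
  · subst h
    rw [Matrix.mul_transvection_apply_same, if_pos rfl]
  · rw [Matrix.mul_transvection_apply_of_ne _ _ _ _ h, if_neg h, add_zero]

lemma rootElt_mem_U (β : PosRoot n) (c : F) : rootElt β c ∈ U n F := by
  have hlt := β.lt
  refine ⟨fun i => ?_, fun i j hij => ?_⟩
  · rw [rootElt_apply, if_neg, Matrix.one_apply_eq, add_zero]
    rintro ⟨rfl, h⟩
    exact hlt.ne' h
  · rw [rootElt_apply, if_neg, Matrix.one_apply_ne hij.ne', add_zero]
    rintro ⟨rfl, rfl⟩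
    exact lt_asymm hij hlt

lemma rootGenerated_le_U (S : Set (PosRoot n)) : rootGenerated F S ≤ U n F := by
  refine iSup₂_le fun β _ => ?_
  rintro _ ⟨c, rfl⟩
  exact rootElt_mem_U β c

lemma rootElt_mem_rootGenerated {S : Set (PosRoot n)} {β : PosRoot n} (hβ : β ∈ S) (c : F) :
    rootElt β c ∈ rootGenerated F S :=
  (le_iSup₂_of_le β hβ le_rfl : rootSubgroup F β ≤ rootGenerated F S) ⟨c, rfl⟩

lemma eq_one_of_mem_U {g : GL (Fin n) F} (hg : g ∈ U n F) (h : ∀ i j, i < j → g i j = 0) :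
    g = 1 := by
  refine Units.ext (Matrix.ext fun i j => ?_)
  rcases lt_trichotomy i j with hij | rfl | hij
  · rw [h i j hij, Units.val_one, Matrix.one_apply_ne hij.ne]
  · rw [hg.1, Units.val_one, Matrix.one_apply_eq]
  · rw [hg.2 i j hij, Units.val_one, Matrix.one_apply_ne hij.ne']

open Classical in
/-- A unitriangular matrix lies in the group generated by the root subgroups of the positions of
its nonzero entries. -/
lemma mem_rootGenerated_of_support {S : Set (PosRoot n)} {g : GL (Fin n) F} (hg : g ∈ U n F)
    (hS : ∀ β : PosRoot n, β ∉ S → g β.row β.col = 0) : g ∈ rootGenerated F S := by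
  let supp : GL (Fin n) F → Finset (Fin n × Fin n) :=
    fun g => Finset.univ.filter fun p => p.1 < p.2 ∧ g p.1 p.2 ≠ 0
  have hsupp : ∀ g p, p ∈ supp g ↔ p.1 < p.2 ∧ g p.1 p.2 ≠ 0 := fun g p => by simp [supp]
  induction hm : (supp g).card using Nat.strong_induction_on generalizing g with
  | _ m ih =>
    rcases (supp g).eq_empty_or_nonempty with he | hne
    · have : g = 1 := eq_one_of_mem_U hg fun i j hij => by
        by_contra h
        have : (i, j) ∈ supp g := (hsupp _ _).2 ⟨hij, h⟩
        simp [he] at this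
      rw [this]
      exact one_mem _
    -- Choosing the nonzero entry (i, j) in the leftmost possible column makes column i < j of g a
    -- unit vector, so the column operation that clears (i, j) changes no other entry.
    · obtain ⟨⟨i, j⟩, hp, hmin⟩ := Finset.exists_min_image (supp g) Prod.snd hne
      obtain ⟨hij, hgij⟩ := (hsupp _ _).1 hp
      let β : PosRoot n := ⟨i, j, hij⟩
      have hβ : β ∈ S := by
        by_contra h
        exact hgij (hS β h)
      have hcol : ∀ k, g k i = (1 : Matrix (Fin n) (Fin n) F) k i := by
        intro k
        rcases lt_trichotomy k i with h | rfl | h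
        · rw [Matrix.one_apply_ne h.ne]
          by_contra h0
          exact absurd hij (hmin (k, i) ((hsupp _ _).2 ⟨h, h0⟩)).not_gt
        · rw [hg.1, Matrix.one_apply_eq]
        · rw [hg.2 _ _ h, Matrix.one_apply_ne h.ne']
      let g' := g * rootElt β (-g i j)
      have hg' : ∀ k l, g' k l = if k = i ∧ l = j then 0 else g k l := by
        intro k l
        rw [mul_rootElt_apply]
        change g k l + (if l = j then -g i j * g k i else 0) = _
        rw [hcol]
        by_cases hl : l = j
        · subst hl
          by_cases hk : k = i
          · subst hk
            simp
          · simp [hk]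
        · simp [hl]
      have hss : supp g' ⊂ supp g := by
        rw [Finset.ssubset_iff_of_subset]
        · refine ⟨(i, j), hp, fun h => ((hsupp _ _).1 h).2 ?_⟩
          rw [hg', if_pos ⟨rfl, rfl⟩]
        · intro p hp
          rw [hsupp] at hp ⊢
          refine ⟨hp.1, fun h => hp.2 ?_⟩
          rw [hg', h, ite_self]
      have := ih _ (hm ▸ Finset.card_lt_card hss) (mul_mem hg (rootElt_mem_U β _))
        (fun γ hγ => by rw [hg', hS γ hγ, ite_self]) rfl
      have h2 := mul_mem this (rootElt_mem_rootGenerated hβ (g i j))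
      rwa [← inv_rootElt, inv_mul_cancel_right] at h2

/-- This replaces the generated group by vanishing conditions on one row, the form in which
membership is checked from here on. -/
lemma mem_baseGroup_iff {α : PosRoot n} {g : GL (Fin n) F} :
    g ∈ baseGroup F α ↔ g ∈ U n F ∧ ∀ k, α.row < k → k < α.col → g α.row k = 0 := by
  refine ⟨fun h => baseGroup_le_armFree α h, fun h => mem_rootGenerated_of_support h.1 ?_⟩
  intro β hβ
  obtain ⟨h1, h2⟩ : β.row = α.row ∧ β.col < α.col := not_not.1 hβ
  rw [h1]
  exact h.2 _ (h1 ▸ β.lt) h2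

lemma exists_mem_U_of_matrix (M : Matrix (Fin n) (Fin n) F) (h1 : ∀ i, M i i = 1)
    (h0 : ∀ i j, j < i → M i j = 0) : ∃ g ∈ U n F, (g : Matrix (Fin n) (Fin n) F) = M := by
  have hdet : M.det ≠ 0 := by
    rw [Matrix.det_of_isUpperTriangular (fun i j hij => h0 i j hij)]
    simp [h1]
  exact ⟨Matrix.GeneralLinearGroup.mkOfDetNeZero M hdet, ⟨h1, h0⟩, rfl⟩

variable {D : Finset (PosRoot n)}

lemma mem_VD_iff (hD : D.Nonempty) {g : GL (Fin n) F} :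
    g ∈ VD F D ↔ g ∈ U n F ∧ ∀ α ∈ D, ∀ k, α.row < k → k < α.col → g α.row k = 0 := by
  simp only [VD, Subgroup.mem_iInf, mem_baseGroup_iff, Subtype.forall]
  obtain ⟨α, hα⟩ := hD
  exact ⟨fun h => ⟨(h α hα).1, fun β hβ => (h β hβ).2⟩, fun h β hβ => ⟨h.1, h.2 β hβ⟩⟩

lemma VD_le_U (hD : D.Nonempty) : VD F D ≤ U n F :=
  fun _ h => ((mem_VD_iff hD).1 h).1

lemma RD_le_U : RD F D ≤ U n F := rootGenerated_le_U _

lemma VDRD_le_U (hD : D.Nonempty) : VDRD F D ≤ U n F := sup_le (VD_le_U hD) RD_le_U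

lemma lamD_apply (ψ : AddChar F ℂ) (s : D → Fˣ) (g : VD F D) :
    lamD ψ D s g = ∏ α : D, ψ (s α * (g : GL (Fin n) F) α.1.row α.1.col) := by
  rw [lamD, MonoidHom.finsetProd_apply]
  rfl

open Classical in
/-- Any family of cosets of the base groups `V_α`, `α ∈ D`, in `U` has a common element. -/
lemma exists_mem_U_forall_inv_mul_mem_baseGroup (hD : IsBasic D) (y : D → U n F) :
    ∃ x : U n F, ∀ α : D, ((x : GL (Fin n) F)⁻¹ * y α : GL (Fin n) F) ∈ baseGroup F α.1 := by
  -- The row of each α is copied from (y α)⁻¹, unambiguously since the rows of D are distinct. For z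
  -- with these rows, z · y α has the row of the identity at α, and x = z⁻¹ is the common element.
  let M : Matrix (Fin n) (Fin n) F := fun i j =>
    if h : ∃ α : D, α.1.row = i then ((y h.choose : GL (Fin n) F)⁻¹ : GL (Fin n) F) i j
    else (1 : Matrix (Fin n) (Fin n) F) i j
  have hM : ∀ (α : D) j, M α.1.row j = ((y α : GL (Fin n) F)⁻¹ : GL (Fin n) F) α.1.row j := by
    intro α j
    have h : ∃ β : D, β.1.row = α.1.row := ⟨α, rfl⟩
    have h1 : h.choose = α := by
      by_contra hne
      exact (hD.2 _ h.choose.2 _ α.2 fun h => hne (Subtype.ext h)).1 h.choose_spec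
    simp only [M]
    rw [dif_pos h, h1]
  obtain ⟨z, hz, hzM⟩ := exists_mem_U_of_matrix M
    (fun i => by
      simp only [M]
      split_ifs with h
      · exact (inv_mem (y h.choose).2).1 i
      · exact Matrix.one_apply_eq i)
    (fun i j hij => by
      simp only [M]
      split_ifs with h
      · exact (inv_mem (y h.choose).2).2 i j hij
      · exact Matrix.one_apply_ne hij.ne')
  refine ⟨⟨z⁻¹, inv_mem hz⟩, fun α => mem_baseGroup_iff.2 ⟨?_, fun k hk _ => ?_⟩⟩
  · exact mul_mem (inv_mem (inv_mem hz)) (y α).2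
  · change (z⁻¹⁻¹ * y α : GL (Fin n) F) α.1.row k = 0
    have h1 : ((y α : GL (Fin n) F)⁻¹ * y α : GL (Fin n) F) α.1.row k = 0 := by
      rw [inv_mul_cancel, Units.val_one, Matrix.one_apply_ne hk.ne]
    rw [inv_inv, Units.val_mul, Matrix.mul_apply, hzM]
    rw [Units.val_mul, Matrix.mul_apply] at h1
    simpa only [hM] using h1

lemma superchar_eq_induce [Finite F] (ψ : AddChar F ℂ) (hD : IsBasic D) (s : D → Fˣ) :
    superchar ψ D s = induce (VD F D) (U n F) (lamD ψ D s) :=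
  prod_induce (fun α : D => baseGroup F α.1) (fun α => lam ψ α.1 (s α))
    (fun α => baseGroup_le_U α.1) (VD_le_U hD.1) (exists_mem_U_forall_inv_mul_mem_baseGroup hD)

end Matrices

/-! ### Invariance and intertwiners of `λ_D` -/

section Invariance

variable {G : Type*} [Group G]

/-- The elements of `G` which, together with their inverses, normalize `N` and preserve a linear
character `l` of `N`. -/
def charStabilizer {N : Subgroup G} (l : N →* ℂ) : Subgroup G where
  carrier := {h | (∀ n (hn : n ∈ N), ∃ hn' : h * n * h⁻¹ ∈ N, l ⟨h * n * h⁻¹, hn'⟩ = l ⟨n, hn⟩) ∧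
    ∀ n (hn : n ∈ N), ∃ hn' : h⁻¹ * n * h ∈ N, l ⟨h⁻¹ * n * h, hn'⟩ = l ⟨n, hn⟩}
  mul_mem' := by
    rintro a b ⟨ha, ha'⟩ ⟨hb, hb'⟩
    refine ⟨fun n hn => ?_, fun n hn => ?_⟩
    · obtain ⟨h1, h2⟩ := hb n hn
      obtain ⟨h3, h4⟩ := ha _ h1
      have : a * b * n * (a * b)⁻¹ = a * (b * n * b⁻¹) * a⁻¹ := by group
      simp only [this]
      exact ⟨h3, h4.trans h2⟩
    · obtain ⟨h1, h2⟩ := ha' n hn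
      obtain ⟨h3, h4⟩ := hb' _ h1
      have : (a * b)⁻¹ * n * (a * b) = b⁻¹ * (a⁻¹ * n * a) * b := by group
      simp only [this]
      exact ⟨h3, h4.trans h2⟩
  one_mem' := by
    constructor <;> intro n hn <;> simp [hn]
  inv_mem' := by
    rintro a ⟨ha, ha'⟩
    exact ⟨by simpa using ha', by simpa using ha⟩

lemma le_charStabilizer {N : Subgroup G} (l : N →* ℂ) : N ≤ charStabilizer l := by
  have key : ∀ m ∈ N, ∀ n (hn : n ∈ N), ∃ hn' : m * n * m⁻¹ ∈ N,
      l ⟨m * n * m⁻¹, hn'⟩ = l ⟨n, hn⟩ := by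
    intro m hm n hn
    refine ⟨mul_mem (mul_mem hm hn) (inv_mem hm), ?_⟩
    have : (⟨m * n * m⁻¹, mul_mem (mul_mem hm hn) (inv_mem hm)⟩ : N) =
        ⟨m, hm⟩ * ⟨n, hn⟩ * ⟨m, hm⟩⁻¹ := rfl
    rw [this, map_mul, map_mul, mul_right_comm, ← map_mul, mul_inv_cancel, map_one, one_mul]
  exact fun m hm => ⟨key m hm, by simpa using key m⁻¹ (inv_mem hm)⟩

/-- Allows an intertwiner to be simplified by left multiplication with elements of R_D. -/
lemma Intertwines.mul_left {N : Subgroup G} {l : N →* ℂ} {w x : G} (hx : Intertwines l x)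
    (hw : w ∈ charStabilizer l) : Intertwines l (w * x) := by
  intro n hn hn'
  obtain ⟨h1, h2⟩ := hw.2 n hn
  have h3 : (w * x)⁻¹ * n * (w * x) = x⁻¹ * (w⁻¹ * n * w) * x := by group
  simp only [h3] at hn' ⊢
  rw [← h2, hx _ h1 hn']

end Invariance

section Matrices

variable {n : ℕ} {F : Type*} [Field F] {D : Finset (PosRoot n)}

/-- Conjugation by `X_γ`, `γ ∈ Γ_D`, does not change the entries of elements of `V_D` on the arms
of `D` and at the positions of `D`. -/
lemma conj_rootElt_apply_of_mem_GammaD (hD : IsBasic D) {γ : PosRoot n} (hγ : γ ∈ GammaD D)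
    (c : F) {g : GL (Fin n) F} (hg : g ∈ VD F D) {α : PosRoot n} (hα : α ∈ D) {k : Fin n}
    (hk : α.row < k) (hk' : k ≤ α.col) :
    (rootElt γ c * g * (rootElt γ c)⁻¹) α.row k = g α.row k := by
  obtain ⟨σ, hσ, τ, hτ, hcol, hrow, hγr, hγc⟩ := hγ
  obtain ⟨hgU, hgD⟩ := (mem_VD_iff hD.1).1 hg
  rw [inv_rootElt, mul_rootElt_apply, rootElt_mul_apply, rootElt_mul_apply, hγr, hγc]
  -- In the row of σ, the row operation adds c times row `τ.row` of g, which up to column `σ.col` <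
  -- `τ.col` has only its diagonal entry. The column operation subtracts that same c again.
  by_cases hr : α.row = σ.row
  · have hασ : α = σ := by
      by_contra hne
      exact (hD.2 α hα σ hσ hne).1 hr
    subst hασ
    rw [if_pos rfl, if_pos rfl, hgU.2 _ _ hrow, hgU.1]
    rcases lt_trichotomy k τ.row with h | rfl | h
    · rw [if_neg h.ne, hgU.2 _ _ h]
      ring
    · rw [if_pos rfl, hgU.1]
      ring
    · rw [if_neg h.ne', hgD τ hτ k h (hk'.trans_lt hcol)]
      ring
  · rw [if_neg hr, if_neg hr]
    -- In any other row only column `τ.row` changes, by a multiple of the entry in column `σ.row`.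
    -- That entry is on the arm of α or below the diagonal, hence zero.
    by_cases hkτ : k = τ.row
    · subst hkτ
      rw [if_pos rfl]
      rcases lt_trichotomy α.row σ.row with h | h | h
      · rw [hgD α hα σ.row h (hrow.trans_le hk')]
        ring
      · exact absurd h hr
      · rw [hgU.2 _ _ h]
        ring
    · rw [if_neg hkτ]
      ring

lemma VDRD_le_charStabilizer (ψ : AddChar F ℂ) (hD : IsBasic D) (s : D → Fˣ) :
    VDRD F D ≤ charStabilizer (lamD ψ D s) := by
  refine sup_le (le_charStabilizer _) (iSup₂_le fun γ hγ => ?_)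
  have key : ∀ (c : F) g (hg : g ∈ VD F D),
      ∃ hg' : rootElt γ c * g * (rootElt γ c)⁻¹ ∈ VD F D,
        lamD ψ D s ⟨rootElt γ c * g * (rootElt γ c)⁻¹, hg'⟩ = lamD ψ D s ⟨g, hg⟩ := by
    intro c g hg
    obtain ⟨hgU, hgD⟩ := (mem_VD_iff hD.1).1 hg
    refine ⟨(mem_VD_iff hD.1).2 ⟨mul_mem (mul_mem (rootElt_mem_U _ _) hgU)
      (inv_mem (rootElt_mem_U _ _)), fun α hα k hk hk' => ?_⟩, ?_⟩
    · rw [conj_rootElt_apply_of_mem_GammaD hD hγ c hg hα hk hk'.le, hgD α hα k hk hk']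
    · rw [lamD_apply, lamD_apply]
      refine Finset.prod_congr rfl fun α _ => ?_
      dsimp only
      rw [conj_rootElt_apply_of_mem_GammaD hD hγ c hg α.2 α.1.lt le_rfl]
  rintro _ ⟨c, rfl⟩
  refine ⟨key c, ?_⟩
  have := key (-c)
  rwa [← inv_rootElt, inv_inv] at this

lemma isInvariantChar_lamD (ψ : AddChar F ℂ) (hD : IsBasic D) (s : D → Fˣ) :
    IsInvariantChar (VD F D) (VDRD F D) (lamD ψ D s) :=
  fun _ hh => (VDRD_le_charStabilizer ψ hD s hh).1

lemma coe_VDRD (hD : IsBasic D) :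
    (VDRD F D : Set (GL (Fin n) F)) = (VD F D : Set (GL (Fin n) F)) * (RD F D : Set _) := by
  refine Subgroup.coe_mul_of_right_le_normalizer_left _ _ fun h hh => ?_
  -- Only normalization of V_D is needed here, so the trivial additive character and arbitrary
  -- scalars serve.
  have hst := VDRD_le_charStabilizer (1 : AddChar F ℂ) hD (fun _ => 1)
    ((le_sup_right : RD F D ≤ VDRD F D) hh)
  rw [Subgroup.mem_normalizer_iff]
  refine fun g => ⟨fun hg => (hst.1 g hg).1, fun hg => ?_⟩
  have := (hst.2 _ hg).1
  simpa [mul_assoc] using this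

/-- The conjugate is the identity plus t times a rank-one matrix: column `β.row` of x times row
`β.col` of x⁻¹. -/
lemma conj_rootElt_apply (x : GL (Fin n) F) (β : PosRoot n) (t : F) {i j : Fin n} (hij : i ≠ j) :
    (x * rootElt β t * x⁻¹) i j = t * x i β.row * (x⁻¹ : GL (Fin n) F) β.col j := by
  have h1 : (x * x⁻¹ : GL (Fin n) F) i j = 0 := by
    rw [mul_inv_cancel, Units.val_one, Matrix.one_apply_ne hij]
  rw [Units.val_mul, Matrix.mul_apply] at h1 ⊢
  simp only [mul_rootElt_apply, add_mul, Finset.sum_add_distrib]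
  rw [h1, zero_add, Finset.sum_eq_single β.col, if_pos rfl]
  · intro k _ hk
    rw [if_neg hk, zero_mul]
  · simp

/-- If an intertwiner `x` vanishes on the arms of the roots of `D` to the right of `α`, an entry
of `x` on the arm of `α` vanishes unless its column is the row of a root of `D` to the right
of `α`. -/
lemma Intertwines.apply_eq_zero {ψ : AddChar F ℂ} (hψ : ψ ≠ 1) (hD : IsBasic D) {s : D → Fˣ}
    {x : GL (Fin n) F} (hx : Intertwines (lamD ψ D s) x) (hxU : x ∈ U n F) {α : PosRoot n}
    (hα : α ∈ D)
    (hvan : ∀ ρ ∈ D, α.col < ρ.col → ∀ k, ρ.row < k → k < ρ.col → x ρ.row k = 0)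
    {l : Fin n} (hl : α.row < l) (hl' : l < α.col)
    (hnot : ∀ ρ ∈ D, α.col < ρ.col → ρ.row ≠ l) : x α.row l = 0 := by
  by_contra hne
  obtain ⟨u, hu⟩ := AddChar.ne_one_iff.1 hψ
  let β : PosRoot n := ⟨l, α.col, hl'⟩
  -- Chosen so that λ_D takes the value ψ(u) ≠ 1 on the conjugate x x_β(t) x⁻¹, whereas it is 1 on
  -- x_β(t).
  let t : F := u / (s ⟨α, hα⟩ * x α.row l)
  have hiU := inv_mem hxU
  have hzero : ∀ ρ ∈ D, α.col < ρ.col → x ρ.row l = 0 := by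
    intro ρ hρ hc
    rcases lt_trichotomy ρ.row l with h | h | h
    · exact hvan ρ hρ hc l h (hl'.trans hc)
    · exact absurd h (hnot ρ hρ hc)
    · exact hxU.2 _ _ h
  -- Position (l, `α.col`) could only be on the arm of a root in row l further right than α, which
  -- `hnot` excludes.
  have hv : rootElt β t ∈ VD F D := by
    refine (mem_VD_iff hD.1).2 ⟨rootElt_mem_U _ _, fun ρ hρ k hk hk' => ?_⟩
    rw [rootElt_apply, Matrix.one_apply_ne hk.ne, if_neg, add_zero]
    rintro ⟨h1, h2⟩
    exact hnot ρ hρ (lt_of_eq_of_lt h2 hk') h1.symm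
  have hg : x * rootElt β t * x⁻¹ ∈ VD F D := by
    refine (mem_VD_iff hD.1).2 ⟨mul_mem (mul_mem hxU (rootElt_mem_U _ _)) hiU,
      fun ρ hρ k hk hk' => ?_⟩
    rw [conj_rootElt_apply x β t hk.ne]
    rcases lt_or_ge k α.col with h | h
    · rw [show (x⁻¹ : GL (Fin n) F) β.col k = 0 from hiU.2 _ _ h, mul_zero]
    · rw [show x ρ.row β.row = 0 from hzero ρ hρ (h.trans_lt hk'), mul_zero, zero_mul]
  have hconj : x⁻¹ * (x * rootElt β t * x⁻¹) * x = rootElt β t := by group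
  have key := hx _ hg (hconj.symm ▸ hv)
  simp only [hconj] at key
  rw [lamD_apply, lamD_apply, Finset.prod_eq_single ⟨α, hα⟩, Finset.prod_eq_one] at key
  · dsimp only at key
    rw [conj_rootElt_apply x β t α.lt.ne, show (x⁻¹ : GL (Fin n) F) β.col α.col = 1 from hiU.1 _,
      mul_one] at key
    apply hu
    rw [← key]
    congr 1
    change u = s ⟨α, hα⟩ * (u / (s ⟨α, hα⟩ * x α.row l) * x α.row l)
    have := (s ⟨α, hα⟩).ne_zero
    field_simp
  · intro ρ _
    dsimp only
    rw [rootElt_apply, Matrix.one_apply_ne ρ.1.lt.ne, if_neg, add_zero, mul_zero,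
      AddChar.map_zero_eq_one]
    rintro ⟨h1, h2⟩
    have : ρ.1 = α := by
      by_contra h
      exact (hD.2 _ ρ.2 _ hα h).2 h2.symm
    rw [this] at h1
    exact hl.ne' h1
  · intro ρ _ hρ
    dsimp only
    rw [conj_rootElt_apply x β t ρ.1.lt.ne]
    have hcol : ρ.1.col ≠ α.col := (hD.2 _ ρ.2 _ hα fun h => hρ (Subtype.ext h)).2
    rcases lt_or_gt_of_ne hcol with h | h
    · rw [show (x⁻¹ : GL (Fin n) F) β.col ρ.1.col = 0 from hiU.2 _ _ h, mul_zero, mul_zero,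
        AddChar.map_zero_eq_one]
    · rw [show x ρ.1.row β.row = 0 from hzero _ ρ.2 h, mul_zero, zero_mul, mul_zero,
        AddChar.map_zero_eq_one]
  · simp

/-- Clearing the arm of `α` in `x` by left multiplication with an element of `R_D`. -/
lemma exists_mem_RD_mul_apply_eq_zero {x : GL (Fin n) F} (hxU : x ∈ U n F) {α : PosRoot n}
    (hα : α ∈ D)
    (hvan : ∀ ρ ∈ D, α.col < ρ.col → ∀ k, ρ.row < k → k < ρ.col → x ρ.row k = 0)
    (hrow : ∀ l, α.row < l → l < α.col → (∀ ρ ∈ D, α.col < ρ.col → ρ.row ≠ l) →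
      x α.row l = 0) :
    ∃ w ∈ RD F D, (∀ k, α.row < k → k < α.col → (w * x) α.row k = 0) ∧
      ∀ i, i ≠ α.row → ∀ k, (w * x) i k = x i k := by
  classical
  -- The identity with the negated arm entries of x in the row of α; by `hrow` its nonzero
  -- off-diagonal positions belong to Γ_D.
  let M : Matrix (Fin n) (Fin n) F := fun i j =>
    (1 : Matrix (Fin n) (Fin n) F) i j +
      if i = α.row ∧ α.row < j ∧ j < α.col then - x α.row j else 0
  have hMrow : ∀ i, i ≠ α.row → ∀ j, M i j = (1 : Matrix (Fin n) (Fin n) F) i j := by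
    intro i hi j
    simp [M, hi]
  obtain ⟨w, hwU, hw⟩ := exists_mem_U_of_matrix M
    (fun i => by
      simp only [M]
      rw [Matrix.one_apply_eq, if_neg, add_zero]
      rintro ⟨rfl, h, -⟩
      exact lt_irrefl _ h)
    (fun i j hij => by
      simp only [M]
      rw [Matrix.one_apply_ne hij.ne', if_neg, add_zero]
      rintro ⟨rfl, h, -⟩
      exact lt_asymm h hij)
  refine ⟨w, mem_rootGenerated_of_support hwU fun β hβ => ?_, fun k hk hk' => ?_, fun i hi k => ?_⟩
  · rw [hw]
    simp only [M]
    rw [Matrix.one_apply_ne β.lt.ne, zero_add]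
    split_ifs with h
    · obtain ⟨h1, h2, h3⟩ := h
      rw [hrow _ h2 h3, neg_zero]
      intro ρ hρ hc hr
      exact hβ ⟨α, hα, ρ, hρ, hc, hr ▸ h2, h1, hr.symm⟩
    · rfl
  · rw [Units.val_mul, Matrix.mul_apply, hw]
    simp only [M, add_mul, Finset.sum_add_distrib, Matrix.one_apply, ite_mul, one_mul, zero_mul,
      Finset.sum_ite_eq, Finset.mem_univ, if_true]
    rw [Finset.sum_eq_single k]
    · rw [if_pos ⟨trivial, hk, hk'⟩, hxU.1]
      ring
    -- No other term disturbs the cancellation: either x vanishes at (`α.row`, l), or l is the row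
    -- of a root further right, whose arm in x is already clear.
    · intro l _ hlk
      split_ifs with h
      · obtain ⟨-, h2, h3⟩ := h
        by_cases hex : ∀ ρ ∈ D, α.col < ρ.col → ρ.row ≠ l
        · rw [hrow l h2 h3 hex, neg_zero, zero_mul]
        · push Not at hex
          obtain ⟨ρ, hρ, hc, rfl⟩ := hex
          have : x ρ.row k = 0 := by
            rcases lt_or_gt_of_ne hlk with h | h
            · exact hvan ρ hρ hc k h (hk'.trans hc)
            · exact hxU.2 _ _ h
          rw [this, mul_zero]
      · rfl
    · simp
  · rw [Units.val_mul, Matrix.mul_apply, hw]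
    simp only [hMrow i hi, Matrix.one_apply, ite_mul, one_mul, zero_mul, Finset.sum_ite_eq,
      Finset.mem_univ, if_true]

/-- All intertwiners of `λ_D` in `U` lie in `V_D R_D`. -/
lemma containsIntertwiners_lamD {ψ : AddChar F ℂ} (hψ : ψ ≠ 1) (hD : IsBasic D) (s : D → Fˣ) :
    ContainsIntertwiners (VD F D) (VDRD F D) (U n F) (lamD ψ D s) := by
  -- Here m bounds the columns already treated: the arms of roots of D in columns ≥ m are clear. For
  -- m = n this is vacuous; for m = 0 it means x ∈ V_D.
  have key : ∀ m : ℕ, ∀ x ∈ U n F, Intertwines (lamD ψ D s) x →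
      (∀ ρ ∈ D, m ≤ (ρ.col : ℕ) → ∀ k, ρ.row < k → k < ρ.col → x ρ.row k = 0) →
      x ∈ VDRD F D := by
    intro m
    induction m with
    | zero =>
      intro x hxU _ hvan
      exact VD_le_VDRD D ((mem_VD_iff hD.1).2 ⟨hxU, fun ρ hρ => hvan ρ hρ (Nat.zero_le _)⟩)
    | succ m ih =>
      intro x hxU hx hvan
      by_cases hex : ∃ α ∈ D, (α.col : ℕ) = m
      · obtain ⟨α, hα, hm⟩ := hex
        have hvan' : ∀ ρ ∈ D, α.col < ρ.col → ∀ k, ρ.row < k → k < ρ.col → x ρ.row k = 0 :=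
          fun ρ hρ hc => hvan ρ hρ (by rw [← hm]; exact hc)
        obtain ⟨w, hw, hw1, hw2⟩ := exists_mem_RD_mul_apply_eq_zero hxU hα hvan'
          fun l hl hl' hnot => hx.apply_eq_zero hψ hD hxU hα hvan' hl hl' hnot
        have hw' : w ∈ VDRD F D := (le_sup_right : RD F D ≤ VDRD F D) hw
        -- The factor w keeps the intertwining property and does not affect membership in V_D R_D.
        -- It alters only the row of α, so the arms cleared before stay clear.
        refine (Subgroup.mul_mem_cancel_left _ hw').1 (ih _ (mul_mem (RD_le_U hw) hxU)
          (hx.mul_left (VDRD_le_charStabilizer ψ hD s hw')) fun ρ hρ hc k hk hk' => ?_)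
        by_cases hρα : ρ = α
        · subst hρα
          exact hw1 k hk hk'
        · rw [hw2 _ (hD.2 ρ hρ α hα hρα).1]
          refine hvan ρ hρ (lt_of_le_of_ne hc fun h => (hD.2 ρ hρ α hα hρα).2 ?_) k hk hk'
          exact Fin.ext (h.symm.trans hm.symm)
      · push Not at hex
        exact ih x hxU hx fun ρ hρ hc => hvan ρ hρ (lt_of_le_of_ne hc (hex ρ hρ).symm)
  intro x hxU hx
  exact key n x hxU hx fun ρ _ hc => absurd ρ.col.2 (not_lt.2 hc)

end Matrices

end UniTri

end

open UniTri in
theorem mainTheorem3 {F : Type*} [Field F] [Finite F] (n : ℕ)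
    (ψ : AddChar F ℂ) (hψ : ψ ≠ 1)
    (D : Finset (PosRoot n)) (hD : IsBasic D) (s : D → Fˣ) :
    -- the subgroup `⟨V_D, R_D⟩` is the product `V_D R_D`
    (VDRD F D : Set (GL (Fin n) F)) = (VD F D : Set (GL (Fin n) F)) * (RD F D : Set _) ∧
    -- (i) `Irr(ξ) = {χ^U : χ ∈ Irr(V_D R_D, λ_D)}`
    constituents (superchar ψ D s) =
      induce (VDRD F D) (U n F) '' IrrOver (VD F D) (VDRD F D) (lamD ψ D s) ∧
    -- (ii) `ξ = ∑ χ(1) χ^U` over the finite set `Irr(V_D R_D, λ_D)`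
    (IrrOver (VD F D) (VDRD F D) (lamD ψ D s)).Finite ∧
    superchar ψ D s =
      ∑ᶠ χ ∈ IrrOver (VD F D) (VDRD F D) (lamD ψ D s),
        χ 1 • induce (VDRD F D) (U n F) χ ∧
    -- the constituent `χ^U` of `ξ` has multiplicity `χ(1)`
    ∀ χ ∈ IrrOver (VD F D) (VDRD F D) (lamD ψ D s),
      charInner (superchar ψ D s) (induce (VDRD F D) (U n F) χ) = χ 1 := by
  have hNH := VD_le_VDRD (F := F) D
  have hHK := VDRD_le_U (F := F) hD.1
  have hinv := isInvariantChar_lamD ψ hD s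
  have hint := containsIntertwiners_lamD hψ hD s
  rw [superchar_eq_induce ψ hD s]
  refine ⟨coe_VDRD hD, constituents_induce hNH hHK hinv hint, finite_IrrOver _, ?_, fun χ hχ =>
    charInner_induce_eq_apply_one hNH hHK hinv hint hχ⟩
  rw [finsum_mem_eq_finite_toFinset_sum _ (finite_IrrOver _)]
  exact induce_eq_sum_induce hNH hHK hinv
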